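/- **Setting.** An unweighted coordination game is given by a finite directed graph $(V,E)$ without self-loops, $|V|=n$, a finite set $M$ of $m$ colours, a non-empty set $C(i)\subseteq M$ for every node $i$, and integer bonuses $\beta(i,c)$ for $i\in V$, $c\in M$. The players are the nodes; player $i$ chooses a colour $s(i)\in C(i)$ and receives the payoff $$p_i(s)=|\{j : (j\to i)\in E,\ s(j)=s(i)\}|+\beta(i,s(i)).$$ $\mathrm{NE}$ denotes the set of pure Nash equilibria. A query is a function $q:Q\to M$ with $\emptyset\ne Q\subseteq V$ and $q(i)\in C(i)$ for $i\in Q$; a joint strategy $s$ is consistent with $q$ if $s(i)=q(i)$ for all $i\in Q$. The problem $\exists$NE asks whether some $s\in\mathrm{NE}$ is consistent with $q$. Put $|G|=nm+|E|$. Time is the number of elementary steps (array accesses, list operations, arithmetic operations and comparisons) at unit cost; the graph is given by its list of edges. **Algorithm.** Sort $V$ topologically and process the nodes $i$ in this order. Start with $X(i)=\emptyset$, and let $Y$ be the family $(X(k))_{(k\to i)\in E}$, indexed by the predecessors of $i$. For each $c\in C(i)$, let $S$ be the subfamily of those $Z\in Y$ with $c\in Z$, let $Y'=Y\setminus S$ and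 $C'=M\setminus\{c\}$. For $c'\in C'$ let $\kappa(c')=|S|+\beta(i,c)-\beta(i,c')$ if $c'\in C(i)$, and $\kappa(c')=|Y|$ if $c'\notin C(i)$ (such a colour is not available to $i$ and imposes no constraint). If $\kappa(c')<0$ for some $c'\in C'$, reject $c$. Otherwise, as long as there is $c'\in C'$ with $\kappa(c')\ge |Y'|$, remove $c'$ from $C'$ and remove from $Y'$ all sets that contain $c'$. Then consider the bipartite graph whose two sides are $Y'$ and $\{(c',x): c'\in C',\ 1\le x\le\kappa(c')\}$, where $Z$ is joined to $(c',x)$ iff $c'\in Z$. Compute the size of a maximum matching by repeated search for augmenting paths, exploring all copies $(c',x)$ of a colour $c'$ together and at most once per search, and add $c$ to $X(i)$ iff this size is $|Y'|$. After all colours $c\in C(i)$ have been tested, if $i\in Q$: answer NO and stop if $q(i)\notin X(i)$, and otherwise set $X(i)=\{q(i)\}$. If all nodes have been processed, answer YES. **Theorem.** There is an absolute constant $K$ such that, for every unweighted coordination game with bonuses whose graph is acyclic and has out-degree at most one, and for every query $q$: 1. the algorithm answers YES if and only if there is a Nash equilibrium consistent with $q$; 2. if it answers YES then, on termination, for every node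 $i$, $$X(i)=\{s(i) : s\in\mathrm{NE},\ s(j)=q(j)\text{ for all } j\in Q \text{ such that } j=i \text{ or there is a path from } j \text{ to } i\};$$ 3. the algorithm takes at most $K\,|G|^{2.5}$ steps. -/

import Mathlib

namespace DagNE

/-! ### Strategic games and pure Nash equilibria -/

/-- A strategic game with players `ι`: a non-empty set of strategies and a payoff function for
every player. -/
structure StrategicGame (ι : Type) where
  Strategy : ι → Type
  nonempty_strategy : ∀ i, Nonempty (Strategy i)
  payoff : ι → (∀ i, Strategy i) → ℝ

/-- A joint strategy is a (pure) Nash equilibrium if no player can profitably deviate from it. -/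
def StrategicGame.IsNash {ι : Type} [DecidableEq ι] (𝒢 : StrategicGame ι)
    (s : ∀ i, 𝒢.Strategy i) : Prop :=
  ∀ (i : ι) (x : 𝒢.Strategy i), ¬ 𝒢.payoff i s < 𝒢.payoff i (Function.update s i x)

/-! ### Unweighted coordination games on directed graphs -/

/-- The data `((V, E), C, β)` of an unweighted coordination game with `n` nodes and `m` colours:
a loopless directed graph, a colour assignment and an integer bonus function. -/
structure CoordinationGame (n m : ℕ) where
  E : Finset (Fin n × Fin n)
  loopless : ∀ i, (i, i) ∉ E
  C : Fin n → Finset (Fin m)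
  C_nonempty : ∀ i, (C i).Nonempty
  β : Fin n → Fin m → ℤ

namespace CoordinationGame

variable {n m : ℕ}

/-- `G.Edge i j` means that `i → j` is an edge. -/
def Edge (G : CoordinationGame n m) (i j : Fin n) : Prop := (i, j) ∈ G.E

/-- The set `N i` of predecessors of a node. -/
def predecessors (G : CoordinationGame n m) (i : Fin n) : Finset (Fin n) :=
  Finset.univ.filter fun j => (j, i) ∈ G.E

/-- The set of successors of a node. -/
def successors (G : CoordinationGame n m) (i : Fin n) : Finset (Fin n) :=
  Finset.univ.filter fun j => (i, j) ∈ G.E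

/-- The strategic game: player `i` chooses a colour of `C i`, and is paid the number of
predecessors with the same colour plus the bonus of the chosen colour. -/
noncomputable def toStrategicGame (G : CoordinationGame n m) : StrategicGame (Fin n) where
  Strategy i := {c : Fin m // c ∈ G.C i}
  nonempty_strategy i := (G.C_nonempty i).to_subtype
  payoff i s :=
    (((G.predecessors i).filter fun j => (s i).1 = (s j).1).card : ℝ) + (G.β i (s i).1 : ℝ)

/-- Joint strategies: every node picks one of its colours. -/
abbrev JointStrategy (G : CoordinationGame n m) : Type := ∀ i : Fin n, {c : Fin m // c ∈ G.C i}

/-- Pure Nash equilibria of the coordination game. -/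
def IsNE (G : CoordinationGame n m) (s : G.JointStrategy) : Prop := G.toStrategicGame.IsNash s

/-- The graph has no directed cycle. -/
def IsDAG (G : CoordinationGame n m) : Prop := ∀ i, ¬ Relation.TransGen G.Edge i i

/-- Every node has at most one outgoing edge. -/
def OutDegreeAtMostOne (G : CoordinationGame n m) : Prop := ∀ i, (G.successors i).card ≤ 1

/-- The size `|G| = n m + e`. -/
def size (G : CoordinationGame n m) : ℕ := n * m + G.E.card

/-- A query: a partial function from nodes to colours with non-empty domain `Q`
(the nodes where the value is not `none`) that respects the colour assignment. -/
def IsQuery (G : CoordinationGame n m) (q : Fin n → Option (Fin m)) : Prop :=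
  (∃ i c, q i = some c) ∧ ∀ i c, q i = some c → c ∈ G.C i

/-- The joint strategy extends the query. -/
def Consistent (G : CoordinationGame n m) (q : Fin n → Option (Fin m))
    (s : G.JointStrategy) : Prop :=
  ∀ i c, q i = some c → (s i).1 = c

end CoordinationGame

/-! ### Step counting

Unit-cost random access machine: every read or write of an array cell, every operation on list
cells, every arithmetic operation and every comparison of numbers is one elementary step, performed
by `op`; allocating an array costs its number of cells; loops pay one step for every iteration and
for the final test. Arrays are represented by functions. -/

/-- A result together with the number of elementary steps used to compute it. -/
structure Timed (α : Type) where
  val : α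
  time : ℕ

instance : Monad Timed where
  pure a := ⟨a, 0⟩
  bind x f := ⟨(f x.val).val, x.time + (f x.val).time⟩

/-- One elementary operation with the given result. -/
def op {α : Type} (a : α) : Timed α := ⟨a, 1⟩

/-- Allocation and initialisation of an array with `k` cells. -/
def alloc {α : Type} (k : ℕ) (a : α) : Timed α := ⟨a, k⟩

/-- `for a in l do body`, with loop state `s`. -/
def forEach {α σ : Type} : List α → σ → (α → σ → Timed σ) → Timed σ
  | [], s, _ => op s
  | a :: l, s, body => do
    let s ← op s
    let s ← body a s
    forEach l s body

/-- Write into one cell of a two-dimensional array. -/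
def write₂ {α β γ : Type} [DecidableEq α] [DecidableEq β] (A : α → β → γ) (a : α) (b : β) (x : γ) :
    α → β → γ :=
  Function.update A a (Function.update (A a) b x)

/-! ### The algorithm -/

section Algorithm

variable {n m : ℕ}

/-- Topological sorting of the graph with edge list `L`, in `n` rounds; each round appends one node
that is not yet placed and all of whose predecessors are placed. -/
def topologicalSort (L : List (Fin n × Fin n)) : Timed (List (Fin n)) := do
  let placed₀ ← alloc n fun _ : Fin n => false
  let r ← forEach (List.range n) (placed₀, ([] : List (Fin n))) fun _ st => do
    let blocked₀ ← alloc n fun _ : Fin n => false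
    let blocked ← forEach L blocked₀ fun e b => do
      let k ← op e.1
      let j ← op e.2
      let p ← op (st.1 k)
      if p then pure b else op (Function.update b j true)
    let next ← forEach (List.finRange n) (none : Option (Fin n)) fun v next => do
      let p ← op (st.1 v)
      let b ← op (blocked v)
      if p || b then pure next else op (some v)
    match next with
    | none => pure st
    | some v => do
      let placed ← op (Function.update st.1 v true)
      let l ← op (v :: st.2)
      pure (placed, l)
  forEach r.2 [] fun v l => op (v :: l)

/-- The array of the lists of predecessors. -/
def predecessorLists (L : List (Fin n × Fin n)) : Timed (Fin n → List (Fin n)) := do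
  let N₀ ← alloc n fun _ : Fin n => ([] : List (Fin n))
  forEach L N₀ fun e N => do
    let k ← op e.1
    let j ← op e.2
    let l ← op (N j)
    let l' ← op (k :: l)
    op (Function.update N j l')

/-- The pair `(C', Y')`: an array marking the colours of `C'`, the list of the predecessors `k`
whose sets `X k` form the family `Y'`, and the length of this list. -/
structure Remaining (n m : ℕ) where
  cols : Fin m → Bool
  rest : List (Fin n)
  size : ℕ

/-- The sublist (in reverse order) of the nodes `k` of `l` with `c ∉ X k`, and its length. -/
def without (X : Fin n → Fin m → Bool) (c : Fin m) (l : List (Fin n)) :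
    Timed (List (Fin n) × ℕ) :=
  forEach l ([], 0) fun k r => do
    let b ← op (X k c)
    if b then pure r
    else do
      let l' ← op (k :: r.1)
      let z ← op (r.2 + 1)
      pure (l', z)

/-- One pass over the colours: every `c' ∈ C'` whose number of copies is at least the current
`|Y'|` is removed from `C'`, and the sets that contain it are removed from `Y'`. -/
def removeDominated (X : Fin n → Fin m → Bool) (cap : Fin m → ℤ) (st : Remaining n m) :
    Timed (Remaining n m) :=
  forEach (List.finRange m) st fun c' st => do
    let a ← op (st.cols c')
    let k ← op (cap c')
    let big ← op (decide ((st.size : ℤ) ≤ k))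
    if a && big then do
      let cols ← op (Function.update st.cols c' false)
      let r ← without X c' st.rest
      pure ⟨cols, r.1, r.2⟩
    else pure st

/-- The while loop: passes over the colours until `|Y'|` does not change any more. The first
argument bounds the number of passes. -/
def removeAllDominated (X : Fin n → Fin m → Bool) (cap : Fin m → ℤ) :
    ℕ → Remaining n m → Timed (Remaining n m)
  | 0, st => pure st
  | fuel + 1, st => do
    let st' ← removeDominated X cap st
    let same ← op (decide (st'.size = st.size))
    if same then pure st' else removeAllDominated X cap fuel st'

/-- State of the search for an augmenting path: the colours visited so far, the matching (the node
matched with the copy `(c', x)` of the colour `c'`, if any), and whether a path has been found. -/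
structure Search (n m : ℕ) where
  visited : Fin m → Bool
  owner : Fin m → ℕ → Option (Fin n)
  found : Bool

/-- Depth first search for an augmenting path from the node `v` in the bipartite graph in which
`k` is joined to the copies `(c', 0), …, (c', cap c' - 1)` of every colour `c' ∈ C' ∩ X k`.
The matching is augmented along the path if one is found. All copies of a colour have the
same neighbours, so they are explored together, at most once in a search. The first
numerical argument bounds the depth. -/
def augment (X : Fin n → Fin m → Bool) (cols : Fin m → Bool) (cap : Fin m → ℤ) :
    ℕ → Fin n → Search n m → Timed (Search n m)
  | 0, _, s => pure s
  | fuel + 1, v, s =>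
    forEach (List.finRange m) s fun c s => do
      let seen ← op (s.visited c)
      let inX ← op (X v c)
      let inC ← op (cols c)
      if s.found || seen || !inX || !inC then pure s
      else do
        let vis ← op (Function.update s.visited c true)
        let k ← op (cap c)
        forEach (List.range k.toNat) { s with visited := vis } fun x s => do
          if s.found then pure s
          else do
            let o ← op (s.owner c x)
            match o with
            | none => do
              let own ← op (write₂ s.owner c x (some v))
              pure { s with owner := own, found := true }
            | some u => do
              let s ← augment X cols cap fuel u s
              if s.found then do
                let own ← op (write₂ s.owner c x (some v))
                pure { s with owner := own }
              else pure s

/-- The size of a maximum matching of the bipartite graph of `augment` with left side the nodes of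
the list `st.rest`: try to augment the matching from every node in turn. -/
def maximumMatching (X : Fin n → Fin m → Bool) (cap : Fin m → ℤ) (st : Remaining n m) :
    Timed ℕ := do
  let owner₀ ← alloc (m * st.size) fun (_ : Fin m) (_ : ℕ) => (none : Option (Fin n))
  let r ← forEach st.rest (owner₀, 0) fun v r => do
    let vis ← alloc m fun _ : Fin m => false
    let s ← augment X st.cols cap (m + 1) v ⟨vis, r.1, false⟩
    if s.found then do
      let z ← op (r.2 + 1)
      pure (s.owner, z)
    else pure (s.owner, r.2)
  pure r.2

/-- The body of the loop over the colours: is the colour `c` to be added to `X i`? Here `Y` is the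
list of predecessors `k` of `i`, each standing for its set `X k`. -/
def testColour (G : CoordinationGame n m) (X : Fin n → Fin m → Bool) (i : Fin n)
    (Y : List (Fin n)) (c : Fin m) : Timed Bool := do
  -- `S := {Z ∈ Y | c ∈ Z}`, `Y' := Y \ S`
  let r ← without X c Y
  let d ← forEach Y 0 fun _ z => op (z + 1)
  let s ← op (d - r.2)
  -- `C'` consists of all colours but `c`; the number of copies of `c' ∈ C i` is
  -- `cap c' = |S| + β(i, c) - β(i, c')`; a colour outside `C i` cannot be chosen by `i` and imposes
  -- no constraint (as if its bonus were `-∞`), so that it gets as many copies as there are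
  -- predecessors
  let b ← op (G.β i c)
  let t ← op ((s : ℤ) + b)
  let cols₀ ← alloc m fun _ : Fin m => false
  let cap₀ ← alloc m fun _ : Fin m => (0 : ℤ)
  let p ← forEach (List.finRange m) (cols₀, cap₀) fun c' p => do
    let eq ← op (decide (c' = c))
    let cols ← op (Function.update p.1 c' (!eq))
    let inC ← op (decide (c' ∈ G.C i))
    let b' ← op (G.β i c')
    let k ← op (t - b')
    let cap ← op (Function.update p.2 c' (if inC then k else (d : ℤ)))
    pure (cols, cap)
  -- is there `c' ∈ C'` with `cap c' < 0`?
  let bad ← forEach (List.finRange m) false fun c' bad => do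
    let a ← op (p.1 c')
    let k ← op (p.2 c')
    let neg ← op (decide (k < 0))
    pure (bad || (a && neg))
  if bad then pure false
  else do
    let st ← removeAllDominated X p.2 (r.2 + 1) ⟨p.1, r.1, r.2⟩
    let z ← maximumMatching X p.2 st
    op (decide (z = st.size))

/-- Outcome of the algorithm: the answer (`true` for YES), and the sets `X i` on termination, as an
array of membership bits. -/
structure Outcome (n m : ℕ) where
  answer : Bool
  X : Fin n → Fin m → Bool

/-- The body of the main loop: computation of `X i` from the sets of the predecessors of `i`,
followed by the comparison with the query. -/
def processNode (G : CoordinationGame n m) (q : Fin n → Option (Fin m))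
    (N : Fin n → List (Fin n)) (i : Fin n) (X : Fin n → Fin m → Bool) : Timed (Outcome n m) := do
  -- `X i := ∅`
  let X ← forEach (List.finRange m) X fun c X => op (write₂ X i c false)
  let Y ← op (N i)
  let X ← forEach (List.finRange m) X fun c X => do
    let inC ← op (decide (c ∈ G.C i))
    if inC then do
      let ok ← testColour G X i Y c
      if ok then op (write₂ X i c true) else pure X
    else pure X
  let qi ← op (q i)
  match qi with
  | none => pure ⟨true, X⟩
  | some d => do
    let ok ← op (X i d)
    if ok then do
      -- `X i := {q i}`
      let X ← forEach (List.finRange m) X fun c X => op (write₂ X i c false)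
      let X ← op (write₂ X i d true)
      pure ⟨true, X⟩
    else pure ⟨false, X⟩

/-- The algorithm for unweighted DAGs with out-degree at most one. The graph is given by its list
of edges `L`; once the answer is NO the remaining nodes are skipped. -/
def algorithm (G : CoordinationGame n m) (L : List (Fin n × Fin n))
    (q : Fin n → Option (Fin m)) : Timed (Outcome n m) := do
  let order ← topologicalSort L
  let N ← predecessorLists L
  let X₀ ← alloc (n * m) fun (_ : Fin n) (_ : Fin m) => false
  forEach order ⟨true, X₀⟩ fun i r =>
    if r.answer then processNode G q N i r.X else pure r

end Algorithm

end DagNE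

/-! Whether a node plays a best response depends only on its own colour and on those of its
predecessors. The colours of a consistent equilibrium therefore survive the computation: by
induction along the edges, its colour at `i` is supported by its own colours at the predecessors and
so lies in `X i` (`mem_of_bestResponse`). Conversely, a colour in `X i` comes with a supporting
colouring of the predecessors by colours from their sets `X k`. Out-degree at most one makes the
choices above different predecessors independent, so all of them are realised at once by peeling off
sinks (`exists_bestResponse_on`). Nodes outside an ancestor-closed set impose no obstacle, because a
best response always exists (`exists_extension`).

Support is a matching problem. Giving `c` to every predecessor that may take it only helps `c`
against its rivals. Hence `c` is supported iff the other predecessors can be distributed over the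
other colours within the capacities `|S| + β(i,c) - β(i,c')` (`supported_iff`). Setting aside a
colour with room for everybody does not affect this (`feasible_remove`). A failed search for an
augmenting path exhibits colours all of whose copies are owned by nodes confined to these colours.
Together with the unmatched node this violates Hall's condition (`not_feasible_of_closed`), so one
failure is conclusive.

For the time, a potential charges each colour at most once per search (`augment_spec`). After the
removals a colour has fewer copies than there are nodes left, and recursive calls come only from
owned copies, which are as many as the matched nodes (`searchPotential_le`). With `d` predecessors,
a search costs `O((m+1)(d+1))`, a colour `O((m+1)(d+1)^2)` and a node `O(((m+1)(d+1))^2)`. A sum of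
squares is at most the square of the sum, and `|E| ≤ n`, so the total is quadratic in `|G|`, which
is better than required. -/

namespace DagNE

/-! ### Values and running times of timed programs -/

section Timed

variable {α β σ : Type}

@[simp] theorem pure_val (a : α) : (pure a : Timed α).val = a := rfl
@[simp] theorem pure_time (a : α) : (pure a : Timed α).time = 0 := rfl
@[simp] theorem bind_val (x : Timed α) (f : α → Timed β) : (x >>= f).val = (f x.val).val := rfl
@[simp] theorem bind_time (x : Timed α) (f : α → Timed β) :
    (x >>= f).time = x.time + (f x.val).time := rfl
@[simp] theorem op_val (a : α) : (op a).val = a := rfl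
@[simp] theorem op_time (a : α) : (op a).time = 1 := rfl
@[simp] theorem alloc_val (k : ℕ) (a : α) : (alloc k a).val = a := rfl
@[simp] theorem alloc_time (k : ℕ) (a : α) : (alloc k a).time = k := rfl

theorem forEach_cons_time (a : α) (l : List α) (s : σ) (body : α → σ → Timed σ) :
    (forEach (a :: l) s body).time =
      1 + ((body a s).time + (forEach l (body a s).val body).time) := rfl

/-- Loop invariants that relate the traversed part of the list, the state and the time spent. -/
theorem forEach_invariant (motive : List α → σ → ℕ → Prop) (l : List α) (s : σ)
    (body : α → σ → Timed σ) (init : motive [] s 0)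
    (step : ∀ p a r st t, l = p ++ a :: r → motive p st t →
      motive (p ++ [a]) (body a st).val (t + (1 + (body a st).time))) :
    ∃ t, (forEach l s body).time = t + 1 ∧ motive l (forEach l s body).val t := by
  suffices H : ∀ (r p : List α) (st : σ) (t : ℕ), l = p ++ r → motive p st t →
      ∃ t', t + (forEach r st body).time = t' + 1 ∧ motive l (forEach r st body).val t' by
    simpa using H l [] s 0 rfl init
  intro r
  induction r with
  | nil =>
    intro p st t hl hm
    refine ⟨t, rfl, ?_⟩
    rw [List.append_nil] at hl
    subst hl
    exact hm
  | cons a r ih =>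
    intro p st t hl hm
    obtain ⟨t', h1, h2⟩ := ih (p ++ [a]) _ _ (by simp [hl]) (step p a r st t hl hm)
    refine ⟨t', ?_, h2⟩
    rw [forEach_cons_time, ← h1]
    omega

/-- Loop invariants that relate the traversed part of the list and the state. -/
theorem forEach_val_invariant (motive : List α → σ → Prop) (l : List α) (s : σ)
    (body : α → σ → Timed σ) (init : motive [] s)
    (step : ∀ p a r st, l = p ++ a :: r → motive p st → motive (p ++ [a]) (body a st).val) :
    motive l (forEach l s body).val := by
  obtain ⟨t, -, h⟩ := forEach_invariant (fun p st _ => motive p st) l s body init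
    (fun p a r st _ hl hm => step p a r st hl hm)
  exact h

/-- A uniform bound for the time of the iterations bounds the time of a loop. -/
theorem forEach_time_le (I : σ → Prop) (B : ℕ) (l : List α) (s : σ) (body : α → σ → Timed σ)
    (init : I s) (step : ∀ a ∈ l, ∀ st, I st → I (body a st).val ∧ (body a st).time ≤ B) :
    (forEach l s body).time ≤ l.length * (B + 1) + 1 := by
  obtain ⟨t, h1, -, h2⟩ := forEach_invariant
    (fun p st t => I st ∧ t ≤ p.length * (B + 1)) l s body ⟨init, by simp⟩
    (fun p a r st t hl hm => by
      obtain ⟨h1, h2⟩ := step a (by simp [hl]) st hm.1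
      refine ⟨h1, ?_⟩
      have := hm.2
      simp only [List.length_append, List.length_singleton, add_mul, one_mul]
      simp only [mul_add, mul_one] at this ⊢
      omega)
  omega

theorem forEach_time_le' (B : ℕ) (l : List α) (s : σ) (body : α → σ → Timed σ)
    (step : ∀ a ∈ l, ∀ st, (body a st).time ≤ B) :
    (forEach l s body).time ≤ l.length * (B + 1) + 1 :=
  forEach_time_le (fun _ => True) B l s body trivial fun a ha st _ => ⟨trivial, step a ha st⟩

theorem write₂_apply {α β γ : Type} [DecidableEq α] [DecidableEq β] (A : α → β → γ) (a : α) (b : β)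
    (x : γ) (a' : α) (b' : β) :
    write₂ A a b x a' b' = if a' = a ∧ b' = b then x else A a' b' := by
  unfold write₂
  by_cases h : a' = a
  · subst h
    by_cases h' : b' = b <;> simp [h']
  · simp [h]

end Timed

/-! ### The search for an augmenting path -/

section Augment

variable {n m : ℕ} (X : Fin n → Fin m → Bool) (cols : Fin m → Bool) (cap : Fin m → ℤ)

/-- The colours that can be matched with a node. -/
def Allowed (w : Fin n) (c : Fin m) : Prop := X w c = true ∧ cols c = true

/-- The copies of the colours. -/
def copies : Finset ((_ : Fin m) × ℕ) := Finset.univ.sigma fun c => Finset.range (cap c).toNat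

/-- The number of copies that are matched with a given node. -/
def matchCount (o : Fin m → ℕ → Option (Fin n)) (w : Fin n) : ℕ :=
  ∑ p ∈ copies cap, if o p.1 p.2 = some w then 1 else 0

/-- Nodes are matched with allowed colours only. -/
def ValidOwner (o : Fin m → ℕ → Option (Fin n)) : Prop :=
  ∀ c x u, o c x = some u → Allowed X cols u c

/-- The number of colours not yet visited. -/
def unvisited (vis : Fin m → Bool) : ℕ := (Finset.univ.filter fun c => vis c = false).card

/-- The time to be charged to a single colour in one search. -/
def colourCost (o : Fin m → ℕ → Option (Fin n)) (c : Fin m) : ℕ :=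
  -- Opening a colour takes two operations and the final test of its loop. A copy takes the loop
  -- step, the reading of its owner and at most one write. The search from an owner scans `m`
  -- colours at four steps each, plus a final test.
  3 + ∑ x ∈ Finset.range (cap c).toNat, (3 + if (o c x).isSome then 4 * m + 1 else 0)

/-- The time to be charged to the colours that may still be visited in a search. -/
def searchPotential (o : Fin m → ℕ → Option (Fin n)) (vis : Fin m → Bool) : ℕ :=
  ∑ c, if vis c = false ∧ cols c = true then colourCost cap o c else 0

/-- The effect of a part of the search for an augmenting path from `v`; the owners of
the colours in `F` remain unchanged. -/
structure SearchStep (F : Fin m → Bool) (v : Fin n) (s s' : Search n m) : Prop where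
  mono : ∀ c, s.visited c = true → s'.visited c = true
  frame : ∀ c, F c = true → s'.owner c = s.owner c
  owner_eq : s'.found = false → s'.owner = s.owner
  closed : s'.found = false → ∀ c, s'.visited c = true → s.visited c = false →
    ∀ x < (cap c).toNat, ∃ u, s.owner c x = some u ∧ ∀ c', Allowed X cols u c' →
      s'.visited c' = true
  valid : s'.found = true → ValidOwner X cols s.owner → ValidOwner X cols s'.owner
  count : s'.found = true → ∀ w, matchCount cap s'.owner w =
    matchCount cap s.owner w + if v = w then 1 else 0

variable {X cols cap}

/-- Only the copy `(c, x)` changes its contribution. The term of the previous owner stands on the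
left to avoid subtraction in `ℕ`. -/
theorem matchCount_write (o : Fin m → ℕ → Option (Fin n)) (c : Fin m) (x : ℕ) (v w : Fin n)
    (hx : x < (cap c).toNat) :
    matchCount cap (write₂ o c x (some v)) w + (if o c x = some w then 1 else 0) =
      matchCount cap o w + if v = w then 1 else 0 := by
  have hmem : (⟨c, x⟩ : (_ : Fin m) × ℕ) ∈ copies cap := by simp [copies, hx]
  unfold matchCount
  rw [← Finset.add_sum_erase _ _ hmem, ← Finset.add_sum_erase (copies cap) (fun p =>
    if o p.1 p.2 = some w then 1 else 0) hmem]
  have : ∑ p ∈ (copies cap).erase ⟨c, x⟩, (if write₂ o c x (some v) p.1 p.2 = some w then 1 else 0)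
      = ∑ p ∈ (copies cap).erase ⟨c, x⟩, (if o p.1 p.2 = some w then 1 else 0) := by
    refine Finset.sum_congr rfl fun p hp => ?_
    have : ¬ (p.1 = c ∧ p.2 = x) := by
      rintro ⟨h1, h2⟩
      obtain ⟨p1, p2⟩ := p
      simp only at h1 h2
      subst h1 h2
      simp at hp
    rw [write₂_apply, if_neg this]
  rw [this]
  simp only [write₂_apply, and_self, if_true, Option.some.injEq]
  omega

theorem unvisited_mono {vis vis' : Fin m → Bool} (h : ∀ c, vis c = true → vis' c = true) :
    unvisited vis' ≤ unvisited vis := by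
  refine Finset.card_le_card fun c => ?_
  simp only [Finset.mem_filter, Finset.mem_univ, true_and]
  intro hc
  by_contra h'
  simp [h c (by simpa using h')] at hc

theorem unvisited_update {vis : Fin m → Bool} {c : Fin m} (h : vis c = false) :
    unvisited (Function.update vis c true) < unvisited vis := by
  refine Finset.card_lt_card ⟨fun c' => ?_, fun hs => ?_⟩
  · simp only [Finset.mem_filter, Finset.mem_univ, true_and, Function.update_apply]
    split_ifs <;> simp
  · have := hs (Finset.mem_filter.2 ⟨Finset.mem_univ c, h⟩)
    simp at this

/-- Marking a colour releases exactly its cost, which can thus be spent only once in a search. -/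
theorem searchPotential_update (o : Fin m → ℕ → Option (Fin n)) {vis : Fin m → Bool} {c : Fin m}
    (h : vis c = false) (hc : cols c = true) :
    searchPotential cols cap o (Function.update vis c true) + colourCost cap o c =
      searchPotential cols cap o vis := by
  unfold searchPotential
  rw [← Finset.add_sum_erase _ _ (Finset.mem_univ c), ← Finset.add_sum_erase Finset.univ (fun c =>
    if vis c = false ∧ cols c = true then colourCost cap o c else 0) (Finset.mem_univ c)]
  have : ∑ c' ∈ Finset.univ.erase c, (if Function.update vis c true c' = false ∧ cols c' = true then
      colourCost cap o c' else 0) = ∑ c' ∈ Finset.univ.erase c, (if vis c' = false ∧ cols c' = true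
      then colourCost cap o c' else 0) := by
    refine Finset.sum_congr rfl fun c' hc' => ?_
    rw [Function.update_of_ne (Finset.ne_of_mem_erase hc')]
  rw [this]
  simp [h, hc]
  omega

theorem SearchStep.refl (F : Fin m → Bool) (v : Fin n) {s : Search n m} (hs : s.found = false) :
    SearchStep X cols cap F v s s where
  mono _ h := h
  frame _ _ := rfl
  owner_eq _ := rfl
  closed _ c h h' := by simp [h] at h'
  valid h := by simp [hs] at h
  count h := by simp [hs] at h

/-- After a failed first part the owners are unchanged, so what the second part says about them
holds relative to `s`. Colours closed in the first part stay closed because visited sets only grow.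
-/
theorem SearchStep.trans {F F' : Fin m → Bool} {v : Fin n} {s s₁ s₂ : Search n m}
    (h : SearchStep X cols cap F v s s₁) (hs : s₁.found = false)
    (h' : SearchStep X cols cap F' v s₁ s₂) (hF : ∀ c, F c = true → F' c = true) :
    SearchStep X cols cap F v s s₂ where
  mono c hc := h'.mono c (h.mono c hc)
  frame c hc := by rw [h'.frame c (hF c hc), h.frame c hc]
  owner_eq h₂ := by rw [h'.owner_eq h₂, h.owner_eq hs]
  closed h₂ c hc hc' x hx := by
    cases h₁ : s₁.visited c with
    | false =>
      have := h'.closed h₂ c hc h₁ x hx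
      rwa [h.owner_eq hs] at this
    | true =>
      obtain ⟨u, hu, hu'⟩ := h.closed hs c h₁ hc' x hx
      exact ⟨u, hu, fun c' hc' => h'.mono c' (hu' c' hc')⟩
  valid h₂ hv := h'.valid h₂ (by rwa [h.owner_eq hs])
  count h₂ w := by rw [h'.count h₂, h.owner_eq hs]

/-- A failing step does not depend on the starting node. -/
theorem SearchStep.of_fail {F F' : Fin m → Bool} {v v' : Fin n} {s s' : Search n m}
    (h : SearchStep X cols cap F v s s') (hs : s'.found = false) :
    SearchStep X cols cap F' v' s s' where
  mono := h.mono
  frame c _ := by rw [h.owner_eq hs]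
  owner_eq := h.owner_eq
  closed := h.closed
  valid h := by simp [hs] at h
  count h := by simp [hs] at h

/-- A free copy of a colour ends the search. -/
theorem SearchStep.of_free {F : Fin m → Bool} {v : Fin n} {s : Search n m} {c : Fin m} {x : ℕ}
    (hF : F c = false) (hx : x < (cap c).toNat) (ho : s.owner c x = none)
    (hv : Allowed X cols v c) :
    SearchStep X cols cap F v s
      { s with owner := write₂ s.owner c x (some v), found := true } where
  mono _ h := h
  frame c' h := by
    have : c' ≠ c := by rintro rfl; simp [h] at hF
    simp [write₂, this]
  owner_eq h := by simp at h
  closed h := by simp at h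
  valid _ hs c' x' u hu := by
    simp only [write₂_apply] at hu
    split_ifs at hu with h
    · obtain ⟨rfl, rfl⟩ := h
      cases hu
      exact hv
    · exact hs c' x' u hu
  count _ w := by
    have := matchCount_write (cap := cap) s.owner c x v w hx
    simp only [ho, reduceCtorEq, if_false] at this
    simpa using this

/-- An augmenting path from the owner of a copy is extended to the node in question. -/
theorem SearchStep.of_owned {F : Fin m → Bool} {u v : Fin n} {s s' : Search n m} {c : Fin m}
    {x : ℕ} (h : SearchStep X cols cap s.visited u s s') (hF : F c = false)
    (hFs : ∀ c, F c = true → s.visited c = true) (hc : s.visited c = true)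
    (hx : x < (cap c).toNat) (ho : s.owner c x = some u) (hv : Allowed X cols v c)
    (hs' : s'.found = true) :
    SearchStep X cols cap F v s { s' with owner := write₂ s'.owner c x (some v) } where
  mono := h.mono
  frame c' h' := by
    have : c' ≠ c := by rintro rfl; simp [h'] at hF
    simp [write₂, this, h.frame c' (hFs c' h')]
  owner_eq h := by simp [hs'] at h
  closed h := by simp [hs'] at h
  valid _ hs c' x' w hw := by
    simp only [write₂_apply] at hw
    split_ifs at hw with h'
    · obtain ⟨rfl, rfl⟩ := h'
      cases hw
      exact hv
    · exact h.valid hs' hs c' x' w hw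
  count _ w := by
    have h₁ := matchCount_write (cap := cap) s'.owner c x v w hx
    have h₂ := h.count hs' w
    -- The colour `c` was visited before the search from `u`, so that search left its copies alone
    -- and `(c, x)` still belongs to `u`. Handing it to `v` cancels the extra count that `u` gained
    -- on the path.
    rw [h.frame c hc, ho] at h₁
    simp only [Option.some.injEq] at h₁
    simp only
    omega

/-- Correctness and running time of the search for an augmenting path. -/
theorem augment_spec (fuel : ℕ) (v : Fin n) (s : Search n m) (hs : s.found = false)
    (hfuel : unvisited s.visited < fuel) :
    SearchStep X cols cap s.visited v s (augment X cols cap fuel v s).val ∧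
    ((augment X cols cap fuel v s).val.found = false →
      ∀ c, Allowed X cols v c → (augment X cols cap fuel v s).val.visited c = true) ∧
    (augment X cols cap fuel v s).time +
        searchPotential cols cap s.owner (augment X cols cap fuel v s).val.visited ≤
      searchPotential cols cap s.owner s.visited + (4 * m + 1) := by
  induction fuel generalizing v s with
  | zero => omega
  | succ fuel ih =>
    set inner := fun (c : Fin m) (x : ℕ) (s : Search n m) => (do
      if s.found then pure s
      else do
        let o ← op (s.owner c x)
        match o with
        | none => do
          let own ← op (write₂ s.owner c x (some v))
          pure { s with owner := own, found := true }
        | some u => do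
          let s ← augment X cols cap fuel u s
          if s.found then do
            let own ← op (write₂ s.owner c x (some v))
            pure { s with owner := own }
          else pure s : Timed (Search n m)) with hinner
    set body := fun (c : Fin m) (s : Search n m) => (do
      let seen ← op (s.visited c)
      let inX ← op (X v c)
      let inC ← op (cols c)
      if s.found || seen || !inX || !inC then pure s
      else do
        let vis ← op (Function.update s.visited c true)
        let k ← op (cap c)
        forEach (List.range k.toNat) { s with visited := vis } (inner c) :
          Timed (Search n m)) with hbody
    have hrun : augment X cols cap (fuel + 1) v s = forEach (List.finRange m) s body := by
      unfold augment
      rfl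
    rw [hrun]
    -- An iteration pays for its three reads; everything else is drawn from the potential. With the
    -- loop step this makes four per colour, and `4 * m + 1` after the final test.
    have key : ∀ (c : Fin m) (st : Search n m), st.found = false →
        unvisited st.visited < fuel + 1 →
        SearchStep X cols cap st.visited v st (body c st).val ∧
        ((body c st).val.found = false → Allowed X cols v c → (body c st).val.visited c = true) ∧
        (body c st).time + searchPotential cols cap st.owner (body c st).val.visited ≤
          searchPotential cols cap st.owner st.visited + 3 := by
      intro c st hst hun
      by_cases hskip : (st.found || st.visited c || !X v c || !cols c) = true
      · have hval : (body c st).val = st := by simp only [hbody, bind_val, op_val, hskip]; rfl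
        have htime : (body c st).time = 3 := by simp only [hbody, bind_time, op_val, hskip]; rfl
        rw [hval, htime]
        refine ⟨SearchStep.refl _ _ hst, fun _ hv => ?_, by omega⟩
        simpa [hst, hv.1, hv.2] using hskip
      · have hskip' : st.visited c = false ∧ Allowed X cols v c := by
          simpa [hst, and_assoc, Allowed] using hskip
        obtain ⟨hvis, hv⟩ := hskip'
        set st₁ : Search n m := { st with visited := Function.update st.visited c true } with hst₁
        have hval : (body c st).val =
            (forEach (List.range (cap c).toNat) st₁ (inner c)).val := by
          simp only [hbody, bind_val, op_val, hskip]; rfl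
        have htime : (body c st).time =
            5 + (forEach (List.range (cap c).toNat) st₁ (inner c)).time := by
          simp only [hbody, bind_time, op_val, hskip, op_time, Bool.false_eq_true, if_false, hst₁]
          omega
        have hvis₁ : st₁.visited c = true := by simp [hst₁]
        have hmono₁ : ∀ c, st.visited c = true → st₁.visited c = true := fun c' h => by
          simp only [hst₁, Function.update_apply]; split_ifs <;> simp [h]
        -- Marking `c` before descending uses up an unvisited colour, which is why the fuel cannot
        -- run out.
        have hun₁ : unvisited st₁.visited < fuel := by
          have := unvisited_update hvis
          simp only [hst₁]
          omega
        -- The frozen colours are those visited before `c`, so the copies of `c` may still be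
        -- rewritten here. The potential refers to the initial owners, which change only once a path
        -- is found, and then no further copy is explored.
        obtain ⟨t, ht, h1, h2, h3⟩ := forEach_invariant (fun p st' t =>
          SearchStep X cols cap st.visited v st₁ st' ∧
          (st'.found = false → ∀ x ∈ p, ∃ u, st.owner c x = some u ∧
            ∀ c', Allowed X cols u c' → st'.visited c' = true) ∧
          t + searchPotential cols cap st.owner st'.visited ≤
            searchPotential cols cap st.owner st₁.visited +
              (p.map fun x => 3 + if (st.owner c x).isSome then 4 * m + 1 else 0).sum)
          (List.range (cap c).toNat) st₁ (inner c)
          ⟨SearchStep.refl _ _ hst, by simp, by simp⟩ (by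
            rintro p x r st' t hl ⟨h1, h2, h3⟩
            have hx : x < (cap c).toNat := by
              rw [← List.mem_range, hl]; simp
            simp only [List.map_append, List.map_singleton, List.sum_append, List.sum_singleton]
            cases hf : st'.found with
            | true =>
              have hval : (inner c x st').val = st' := by simp [hinner, hf]
              have htime : (inner c x st').time = 0 := by simp [hinner, hf]
              rw [hval, htime]
              exact ⟨h1, by simp [hf], by omega⟩
            | false =>
              have ho' : st'.owner = st.owner := h1.owner_eq hf
              have hvis' : st'.visited c = true := h1.mono c hvis₁
              have hmono' : ∀ c, st.visited c = true → st'.visited c = true :=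
                fun c h => h1.mono c (hmono₁ c h)
              cases ho : st.owner c x with
              | none =>
                have hval : (inner c x st').val =
                    { st' with owner := write₂ st'.owner c x (some v), found := true } := by
                  simp [hinner, hf, ho', ho]
                have htime : (inner c x st').time = 2 := by simp [hinner, hf, ho', ho]
                rw [hval, htime]
                refine ⟨h1.trans hf (SearchStep.of_free hvis hx (by rw [ho', ho]) hv)
                  fun _ h => h, by simp, ?_⟩
                simp only [Option.isSome_none, Bool.false_eq_true, if_false]
                omega
              | some u =>
                obtain ⟨k1, k2, k3⟩ := ih u st' hf ((unvisited_mono h1.mono).trans_lt hun₁)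
                set st₂ := (augment X cols cap fuel u st').val with hst₂
                rw [ho'] at k3
                simp only [Option.isSome_some, if_true]
                cases hf₂ : st₂.found with
                | true =>
                  have hval : (inner c x st').val =
                      { st₂ with owner := write₂ st₂.owner c x (some v) } := by
                    simp [hinner, hf, ho', ho, ← hst₂, hf₂]
                  have htime : (inner c x st').time =
                      2 + (augment X cols cap fuel u st').time := by
                    simp [hinner, hf, ho', ho, ← hst₂, hf₂]
                    omega
                  rw [hval, htime]
                  refine ⟨h1.trans hf (SearchStep.of_owned k1 hvis hmono' hvis' hx
                    (by rw [ho', ho]) hv hf₂) fun _ h => h, by simp [hf₂], ?_⟩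
                  simp only
                  omega
                | false =>
                  have hval : (inner c x st').val = st₂ := by
                    simp [hinner, hf, ho', ho, ← hst₂, hf₂]
                  have htime : (inner c x st').time =
                      1 + (augment X cols cap fuel u st').time := by
                    simp [hinner, hf, ho', ho, ← hst₂, hf₂]
                  rw [hval, htime]
                  refine ⟨h1.trans hf (k1.of_fail hf₂ (F' := st.visited)) fun _ h => h,
                    fun _ y hy => ?_, by omega⟩
                  rcases List.mem_append.1 hy with hy | hy
                  · obtain ⟨w, hw, hw'⟩ := h2 hf y hy
                    exact ⟨w, hw, fun c' hc' => k1.mono c' (hw' c' hc')⟩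
                  · rw [List.mem_singleton] at hy
                    subst hy
                    exact ⟨u, ho, k2 hf₂⟩)
        rw [hval, htime]
        refine ⟨⟨fun c' h => h1.mono c' (hmono₁ c' h), h1.frame, h1.owner_eq, ?_, h1.valid,
          h1.count⟩, fun _ _ => h1.mono c hvis₁, ?_⟩
        · intro hf c' hc' hc'' x hx
          by_cases hcc : c' = c
          · subst hcc
            exact h2 hf x (List.mem_range.2 hx)
          · exact h1.closed hf c' hc' (by simp [hst₁, hcc, hc'']) x hx
        · have h4 := searchPotential_update (cap := cap) st.owner hvis hv.2
          have h5 : ((List.range (cap c).toNat).map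
              fun x => 3 + if (st.owner c x).isSome then 4 * m + 1 else 0).sum + 3 =
              colourCost cap st.owner c := by
            rw [colourCost, add_comm]
            rfl
          have h6 : searchPotential cols cap st.owner st₁.visited =
            searchPotential cols cap st.owner (Function.update st.visited c true) := rfl
          omega
    obtain ⟨t, ht, h1, h2, h3⟩ := forEach_invariant (fun p st t =>
      SearchStep X cols cap s.visited v s st ∧
      (st.found = false → ∀ c ∈ p, Allowed X cols v c → st.visited c = true) ∧
      t + searchPotential cols cap s.owner st.visited ≤
        searchPotential cols cap s.owner s.visited + 4 * p.length)
      (List.finRange m) s body ⟨SearchStep.refl _ _ hs, by simp, by simp⟩ (by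
        rintro p c r st t hl ⟨h1, h2, h3⟩
        cases hf : st.found with
        | true =>
          have hval : (body c st).val = st := by simp [hbody, hf]
          have htime : (body c st).time = 3 := by simp [hbody, hf]
          rw [hval, htime]
          refine ⟨h1, by simp [hf], ?_⟩
          simp only [List.length_append, List.length_singleton]
          omega
        | false =>
          obtain ⟨k1, k2, k3⟩ := key c st hf ((unvisited_mono h1.mono).trans_lt hfuel)
          rw [h1.owner_eq hf] at k3
          refine ⟨h1.trans hf k1 h1.mono, fun hf' c' hc' hv => ?_, ?_⟩
          · rcases List.mem_append.1 hc' with hc' | hc'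
            · exact k1.mono c' (h2 hf c' hc' hv)
            · rw [List.mem_singleton] at hc'
              subst hc'
              exact k2 hf' hv
          · simp only [List.length_append, List.length_singleton]
            omega)
    refine ⟨h1, fun hf c hc => h2 hf c (List.mem_finRange c) hc, ?_⟩
    rw [List.length_finRange] at h3
    omega

end Augment

/-! ### The matching test -/

section Matching

variable {n m : ℕ} (X : Fin n → Fin m → Bool) (cols : Fin m → Bool) (cap : Fin m → ℤ)

/-- The nodes in `A` can be assigned allowed colours without exceeding the capacities. -/
def Feasible (A : Finset (Fin n)) : Prop :=
  ∃ f : Fin n → Fin m, (∀ k ∈ A, Allowed X cols k (f k)) ∧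
    ∀ c, cols c = true → ((A.filter fun k => f k = c).card : ℤ) ≤ cap c

variable {X cols cap}

theorem sum_matchCount (o : Fin m → ℕ → Option (Fin n)) :
    ∑ w, matchCount cap o w =
      ∑ c, ∑ x ∈ Finset.range (cap c).toNat, if (o c x).isSome then 1 else 0 := by
  unfold matchCount copies
  rw [Finset.sum_comm, Finset.sum_sigma]
  refine Finset.sum_congr rfl fun c _ => Finset.sum_congr rfl fun x _ => ?_
  cases h : o c x with
  | none => simp
  | some u => simp

/-- The expensive charges `4 * m + 1` belong to owned copies, whose number is the size of the
matching and not the number of all copies. The capacity bound limits the remaining charges to `3 + 3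
* d` per colour. -/
theorem searchPotential_le (o : Fin m → ℕ → Option (Fin n)) (vis : Fin m → Bool) (d : ℕ)
    (hcap : ∀ c, cols c = true → cap c < d) :
    searchPotential cols cap o vis ≤
      m * (3 + 3 * d) + (4 * m + 1) * ∑ w, matchCount cap o w := by
  rw [sum_matchCount, Finset.mul_sum]
  have : m * (3 + 3 * d) = ∑ _c : Fin m, (3 + 3 * d) := by simp
  rw [this, ← Finset.sum_add_distrib]
  refine Finset.sum_le_sum fun c _ => ?_
  split_ifs with h
  · have h1 : (cap c).toNat ≤ d := by have := hcap c h.2; omega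
    have h2 : ∑ x ∈ Finset.range (cap c).toNat, (if (o c x).isSome then 4 * m + 1 else 0) =
        (4 * m + 1) * ∑ x ∈ Finset.range (cap c).toNat, (if (o c x).isSome then 1 else 0) := by
      rw [Finset.mul_sum]
      exact Finset.sum_congr rfl fun x _ => by split_ifs <;> simp
    rw [colourCost, Finset.sum_add_distrib, h2]
    simp only [Finset.sum_const, Finset.card_range, smul_eq_mul]
    omega
  · omega

theorem matchCount_pos {o : Fin m → ℕ → Option (Fin n)} {c : Fin m} {x : ℕ} {u : Fin n}
    (hx : x < (cap c).toNat) (h : o c x = some u) : 0 < matchCount cap o u := by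
  have hmem : (⟨c, x⟩ : (_ : Fin m) × ℕ) ∈ copies cap := by simp [copies, hx]
  exact Finset.sum_pos' (fun _ _ => Nat.zero_le _) ⟨_, hmem, by simp [h]⟩

theorem matchCount_eq_card (o : Fin m → ℕ → Option (Fin n)) (w : Fin n) :
    matchCount cap o w = ((copies cap).filter fun p => o p.1 p.2 = some w).card := by
  rw [matchCount, Finset.card_filter]

/-- A set of nodes that violates Hall's condition. -/
theorem not_feasible_of_closed {o : Fin m → ℕ → Option (Fin n)} {A : Finset (Fin n)} {v : Fin n}
    (U : Fin m → Bool) (hv : v ∈ A) (hv₀ : matchCount cap o v = 0)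
    (hA : ∀ w, 0 < matchCount cap o w → w ∈ A) (h₁ : ∀ w, matchCount cap o w ≤ 1)
    (hU : ∀ c, U c = true → cols c = true)
    (hclosed : ∀ c, U c = true → ∀ x < (cap c).toNat, ∃ u, o c x = some u ∧
      ∀ c', Allowed X cols u c' → U c' = true)
    (hvU : ∀ c, Allowed X cols v c → U c = true) : ¬ Feasible X cols cap A := by
  rintro ⟨f, hf, hf'⟩
  -- `T` collects the copies of the colours in `U`, and `W` their owners. No node owns two copies,
  -- so `|T| ≤ |W|`. The nodes of `W` and the unmatched `v` are all confined to `U`, so `|W| + 1`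
  -- nodes would have to share `|T|` places.
  set T : Finset ((_ : Fin m) × ℕ) :=
    (Finset.univ.filter fun c => U c = true).sigma fun c => Finset.range (cap c).toNat with hT
  have hTmem : ∀ p ∈ T, U p.1 = true ∧ p.2 < (cap p.1).toNat := by simp [hT]
  set W : Finset (Fin n) := Finset.univ.filter fun w => ∃ p ∈ T, o p.1 p.2 = some w with hW
  have hWA : ∀ w ∈ W, w ∈ A := by
    intro w hw
    obtain ⟨p, hp, hp'⟩ := (Finset.mem_filter.1 hw).2
    exact hA w (matchCount_pos (hTmem p hp).2 hp')
  have hvW : v ∉ W := by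
    intro hw
    obtain ⟨p, hp, hp'⟩ := (Finset.mem_filter.1 hw).2
    have := matchCount_pos (cap := cap) (hTmem p hp).2 hp'
    omega
  have hTW : T.card ≤ W.card := by
    have : ∀ p ∈ T, ∃ w, o p.1 p.2 = some w := fun p hp =>
      let ⟨u, hu, _⟩ := hclosed p.1 (hTmem p hp).1 p.2 (hTmem p hp).2
      ⟨u, hu⟩
    have hne : Nonempty (Fin n) := ⟨v⟩
    choose! g hg using this
    refine Finset.card_le_card_of_injOn g
      (fun p hp => Finset.mem_coe.2 (Finset.mem_filter.2 ⟨Finset.mem_univ _, p, hp, hg p hp⟩)) ?_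
    intro p hp p' hp' hpp
    have h := h₁ (g p)
    rw [matchCount_eq_card, Finset.card_le_one] at h
    have hmem : ∀ p ∈ T, p ∈ copies cap := fun p hp => by simp [copies, (hTmem p hp).2]
    exact h p (Finset.mem_filter.2 ⟨hmem p hp, hg p hp⟩) p'
      (Finset.mem_filter.2 ⟨hmem p' hp', by rw [hpp]; exact hg p' hp'⟩)
  have hWU : ∀ w ∈ insert v W, f w ∈ Finset.univ.filter fun c => U c = true := by
    intro w hw
    refine Finset.mem_filter.2 ⟨Finset.mem_univ _, ?_⟩
    rcases Finset.mem_insert.1 hw with rfl | hw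
    · exact hvU _ (hf w hv)
    · obtain ⟨p, hp, hp'⟩ := (Finset.mem_filter.1 hw).2
      obtain ⟨u, hu, hu'⟩ := hclosed p.1 (hTmem p hp).1 p.2 (hTmem p hp).2
      rw [hp'] at hu
      cases hu
      exact hu' _ (hf w (hWA w hw))
  have hsub : insert v W ⊆ A := Finset.insert_subset hv hWA
  have hle : (insert v W).card ≤ T.card := by
    rw [Finset.card_eq_sum_card_fiberwise hWU, hT, Finset.card_sigma]
    refine Finset.sum_le_sum fun c hc => ?_
    have hc' := hU c (Finset.mem_filter.1 hc).2
    have h2 := hf' c hc'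
    have h3 : ((insert v W).filter fun k => f k = c).card ≤ (A.filter fun k => f k = c).card :=
      Finset.card_le_card (Finset.filter_subset_filter _ hsub)
    rw [Finset.card_range]
    omega
  rw [Finset.card_insert_of_notMem hvW] at hle
  omega

/-- A complete matching yields an assignment. -/
theorem feasible_of_matchCount [Nonempty (Fin m)] {o : Fin m → ℕ → Option (Fin n)} {A : Finset (Fin n)}
    (ho : ValidOwner X cols o) (hA : ∀ w ∈ A, 0 < matchCount cap o w)
    (hcap : ∀ c, cols c = true → 0 ≤ cap c) : Feasible X cols cap A := by
  have : ∀ w ∈ A, ∃ p, p ∈ copies cap ∧ o p.1 p.2 = some w := by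
    intro w hw
    have := hA w hw
    rw [matchCount_eq_card, Finset.card_pos] at this
    obtain ⟨p, hp⟩ := this
    exact ⟨p, (Finset.mem_filter.1 hp).1, (Finset.mem_filter.1 hp).2⟩
  obtain ⟨c₀⟩ := ‹Nonempty (Fin m)›
  have hne : Nonempty ((_ : Fin m) × ℕ) := ⟨⟨c₀, 0⟩⟩
  choose! g hg hg' using this
  refine ⟨fun w => (g w).1, fun w hw => ho _ _ _ (hg' w hw), fun c hc => ?_⟩
  have h : (A.filter fun k => (g k).1 = c).card ≤ (Finset.range (cap c).toNat).card := by
    refine Finset.card_le_card_of_injOn (fun w => (g w).2) ?_ ?_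
    · intro w hw
      have hw' := Finset.mem_filter.1 (Finset.mem_coe.1 hw)
      have := hg w hw'.1
      simp only [copies, Finset.mem_sigma] at this
      rw [← hw'.2]
      exact Finset.mem_coe.2 this.2
    · intro w hw w' hw' heq
      have h1 := Finset.mem_filter.1 (Finset.mem_coe.1 hw)
      have h2 := Finset.mem_filter.1 (Finset.mem_coe.1 hw')
      have h3 := hg' w h1.1
      have h4 := hg' w' h2.1
      simp only at heq
      rw [h1.2, heq] at h3
      rw [h2.2, h3] at h4
      exact Option.some.inj h4
  rw [Finset.card_range] at h
  have := hcap c hc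
  beta_reduce
  omega

/-- Correctness and running time of the matching test. -/
theorem maximumMatching_spec [Nonempty (Fin m)] (st : Remaining n m) (hnd : st.rest.Nodup)
    (hsize : st.size = st.rest.length) (hcap : ∀ c, st.cols c = true → 0 ≤ cap c)
    (hcap' : ∀ c, st.cols c = true → cap c < st.size) :
    ((maximumMatching X cap st).val = st.size ↔ Feasible X st.cols cap st.rest.toFinset) ∧
    (maximumMatching X cap st).time ≤ 9 * (m + 1) * (st.size + 1) ^ 2 := by
  -- One round, with `d = st.size`: `m` for the array, at most `m * (3 + 3 * d) + (4 * m + 1) * d`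
  -- from the potential, `4 * m + 1` for the scan at the root, and 2 for the loop step and the
  -- counter.
  set B := 8 * m + 3 + 7 * m * st.size + st.size with hB
  set body := fun (v : Fin n) (r : (Fin m → ℕ → Option (Fin n)) × ℕ) => (do
    let vis ← alloc m fun _ : Fin m => false
    let s ← augment X st.cols cap (m + 1) v ⟨vis, r.1, false⟩
    if s.found then do
      let z ← op (r.2 + 1)
      pure (s.owner, z)
    else pure (s.owner, r.2) : Timed ((Fin m → ℕ → Option (Fin n)) × ℕ)) with hbody
  have hval : (maximumMatching X cap st).val =
    (forEach st.rest ((fun _ _ => none), 0) body).val.2 := rfl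
  have htime : (maximumMatching X cap st).time =
    m * st.size + (forEach st.rest ((fun _ _ => none), 0) body).time := rfl
  -- As long as all searches succeed, the matching covers exactly the traversed nodes; the first
  -- failure refutes feasibility for the whole list. The inequality on the counts survives failures
  -- and controls the time.
  obtain ⟨t, ht, h1, h2, h3, h4, h5, h6⟩ := forEach_invariant (fun p r t =>
    ValidOwner X st.cols r.1 ∧ (∀ w, matchCount cap r.1 w ≤ p.count w) ∧ r.2 ≤ p.length ∧
    (r.2 = p.length → ∀ w, matchCount cap r.1 w = p.count w) ∧
    (r.2 < p.length → ¬ Feasible X st.cols cap st.rest.toFinset) ∧ t ≤ p.length * B)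
    st.rest ((fun _ _ => none), 0) body
    ⟨fun c x u h => by simp at h, fun w => by simp [matchCount], by simp,
      fun _ w => by simp [matchCount], by simp, by simp⟩ (by
      rintro p v r ⟨o, z⟩ t hl ⟨h1, h2, h3, h4, h5, h6⟩
      simp only at h1 h2 h3 h4 h5 h6
      have hvp : p.count v = 0 := by
        rw [List.count_eq_zero]
        intro hvp
        rw [hl, List.nodup_append] at hnd
        exact hnd.2.2 v hvp v (by simp) rfl
      have hlen : p.length + 1 ≤ st.size := by rw [hsize, hl]; simp
      have hp1 : ∀ w, p.count w ≤ 1 := fun w =>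
        (List.nodup_iff_count_le_one.1 (List.nodup_append.1 (hl ▸ hnd)).1) w
      have hsum : ∑ w, matchCount cap o w ≤ p.length := by
        refine (Finset.sum_le_sum fun w _ => h2 w).trans ?_
        have : ∑ w, p.count w = p.length := by
          have := Multiset.sum_count_eq_card (s := Finset.univ) (m := (p : Multiset (Fin n)))
            (fun _ _ => Finset.mem_univ _)
          simpa using this
        exact this.le
      set s₀ : Search n m := ⟨fun _ => false, o, false⟩ with hs₀
      obtain ⟨k1, k2, k3⟩ := augment_spec (X := X) (cols := st.cols) (cap := cap) (m + 1) v s₀ rfl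
        (by simp [unvisited, hs₀])
      set s := (augment X st.cols cap (m + 1) v s₀).val with hs
      have hpot := searchPotential_le (cols := st.cols) (cap := cap) o s₀.visited st.size hcap'
      have hT : m + (augment X st.cols cap (m + 1) v s₀).time + 2 ≤ B := by
        have e1 : (4 * m + 1) * ∑ w, matchCount cap o w ≤ (4 * m + 1) * st.size :=
          Nat.mul_le_mul_left _ (by omega)
        have e2 : s₀.owner = o := rfl
        rw [e2] at k3
        have e3 : m * (3 + 3 * st.size) = 3 * m + 3 * (m * st.size) := by ring
        have e4 : (4 * m + 1) * st.size = 4 * (m * st.size) + st.size := by ring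
        have e5 : B = 8 * m + 3 + 7 * (m * st.size) + st.size := by rw [hB]; ring
        omega
      have hbt : (body v (o, z)).time ≤ m + (augment X st.cols cap (m + 1) v s₀).time + 1 := by
        simp only [hbody, bind_time, alloc_time, alloc_val, ← hs₀, ← hs]
        cases s.found <;> simp [add_assoc]
      have htime' : t + (1 + (body v (o, z)).time) ≤ (p ++ [v]).length * B := by
        rw [List.length_append, List.length_singleton, add_mul, one_mul]
        omega
      have hcount : ∀ w, (p ++ [v]).count w = p.count w + if v = w then 1 else 0 := fun w => by
        rw [List.count_append, List.count_singleton]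
        simp
      cases hf : s.found with
      | true =>
        have hbv : (body v (o, z)).val = (s.owner, z + 1) := by
          simp [hbody, ← hs₀, ← hs, hf]
        rw [hbv]
        refine ⟨k1.valid hf h1, fun w => ?_, by simpa using h3, fun h w => ?_, fun h => ?_, htime'⟩
        · have := h2 w
          rw [k1.count hf, hcount]
          simp only [hs₀]
          omega
        · rw [k1.count hf, hcount]
          have := h4 (by simpa using h) w
          simp only [hs₀]
          omega
        · exact h5 (by simpa using h)
      | false =>
        have hbv : (body v (o, z)).val = (o, z) := by
          have : s.owner = o := k1.owner_eq hf
          simp [hbody, ← hs₀, ← hs, hf, this]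
        rw [hbv]
        -- The visited colours of the failed search are closed, all of them being new since the
        -- array was cleared. Intersecting with `st.cols` supplies membership in `C'`, which
        -- `SearchStep` does not record.
        have hnot : ¬ Feasible X st.cols cap st.rest.toFinset := by
          refine not_feasible_of_closed (o := o) (v := v) (fun c => s.visited c && st.cols c)
            (by simp [hl]) (by have := h2 v; omega)
            (fun w hw => ?_) (fun w => (h2 w).trans (hp1 w)) (fun c hc => ?_)
            (fun c hc x hx => ?_) (fun c hc => ?_)
          · have : w ∈ p := List.count_pos_iff.1 (hw.trans_le (h2 w))
            simp [hl, this]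
          · simp only [Bool.and_eq_true] at hc
            exact hc.2
          · simp only [Bool.and_eq_true] at hc
            obtain ⟨u, hu, hu'⟩ := k1.closed hf c hc.1 rfl x hx
            exact ⟨u, hu, fun c' hc' => by simp [hu' c' hc', hc'.2]⟩
          · simp [k2 hf c hc, hc.2]
        refine ⟨h1, fun w => ?_, by simp; omega, fun h => ?_, fun _ => hnot, htime'⟩
        · have := h2 w
          rw [hcount]
          simp only
          omega
        · simp at h; omega)
  refine ⟨?_, ?_⟩
  · rw [hval, hsize]
    constructor
    · intro h
      refine feasible_of_matchCount h1 (fun w hw => ?_) hcap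
      rw [h4 h]
      exact List.count_pos_iff.2 (List.mem_toFinset.1 hw)
    · intro h
      by_contra h'
      exact h5 (lt_of_le_of_ne h3 h') h
  · rw [htime, ht]
    rw [← hsize] at h6
    have : st.size * B + m * st.size + 1 ≤ 9 * (m + 1) * (st.size + 1) ^ 2 := by
      rw [hB]
      nlinarith [Nat.zero_le (m * st.size), Nat.zero_le (m * st.size * st.size)]
    omega

end Matching

/-! ### The test of a colour -/

section TestColour

variable {n m : ℕ} {X : Fin n → Fin m → Bool} {cols : Fin m → Bool} {cap : Fin m → ℤ}

theorem without_val (c : Fin m) (l : List (Fin n)) :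
    (without X c l).val =
      ((l.filter fun k => !X k c).reverse, (l.filter fun k => !X k c).length) := by
  refine forEach_val_invariant
    (fun p r => r = ((p.filter fun k => !X k c).reverse, (p.filter fun k => !X k c).length))
    l ([], 0) _ rfl ?_
  rintro p a r _ - rfl
  cases h : X a c <;> simp [h]

theorem without_time (c : Fin m) (l : List (Fin n)) :
    (without X c l).time ≤ 4 * l.length + 1 := by
  have := forEach_time_le' 3 l (([], 0) : List (Fin n) × ℕ) (fun k r => (do
    let b ← op (X k c)
    if b then pure r
    else do
      let l' ← op (k :: r.1)
      let z ← op (r.2 + 1)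
      pure (l', z) : Timed (List (Fin n) × ℕ)))
    (fun a _ st => by cases X a c <;> simp)
  unfold without
  omega

/-- A colour with enough copies for all nodes can be set aside. -/
theorem feasible_remove {A : Finset (Fin n)} {c : Fin m} (hc : cols c = true)
    (hA : (A.card : ℤ) ≤ cap c) :
    Feasible X (Function.update cols c false) cap (A.filter fun k => X k c = false) ↔
      Feasible X cols cap A := by
  constructor
  · rintro ⟨f, hf, hf'⟩
    -- Every node that may take `c` takes it. There is room for all of `A`, and the other colours
    -- carry only the load of the remaining nodes.
    refine ⟨fun k => if X k c = true then c else f k, fun k hk => ?_, fun c' hc' => ?_⟩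
    · by_cases h : X k c = true
      · simp [Allowed, h, hc]
      · have := hf k (by simpa [hk] using h)
        simp only [Allowed, Function.update_apply] at this
        simp only [h, Allowed]
        split_ifs at this <;> simp_all
    · by_cases h : c' = c
      · subst h
        exact (Int.ofNat_le.2 (Finset.card_filter_le _ _)).trans hA
      · refine le_trans (Int.ofNat_le.2 (Finset.card_le_card fun k hk => ?_))
          (hf' c' (by simp [h, hc']))
        simp only [Finset.mem_filter] at hk ⊢
        obtain ⟨hk, hk'⟩ := hk
        split_ifs at hk' with h'
        · exact absurd hk'.symm h
        · exact ⟨⟨hk, by simpa using h'⟩, hk'⟩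
  · rintro ⟨f, hf, hf'⟩
    refine ⟨f, fun k hk => ?_, fun c' hc' => ?_⟩
    · have hk' := Finset.mem_filter.1 hk
      have h1 := hf k hk'.1
      have : f k ≠ c := by
        rintro h
        have := h1.1
        rw [h, hk'.2] at this
        cases this
      exact ⟨h1.1, by simp [this, h1.2]⟩
    · refine le_trans (Int.ofNat_le.2 (Finset.card_le_card
        (Finset.filter_subset_filter _ (Finset.filter_subset _ _)))) (hf' c' ?_)
      simp only [Function.update_apply] at hc'
      split_ifs at hc'
      exact hc'

/-- Well-formed pairs `(C', Y')`. -/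
def Remaining.WF (st : Remaining n m) : Prop := st.rest.Nodup ∧ st.size = st.rest.length

/-- The effect of removing dominated colours. -/
structure RemoveStep (X : Fin n → Fin m → Bool) (cap : Fin m → ℤ) (st st' : Remaining n m) :
    Prop where
  wf : st'.WF
  size_le : st'.size ≤ st.size
  cols_le : ∀ c, st'.cols c = true → st.cols c = true
  feasible_iff : Feasible X st'.cols cap st'.rest.toFinset ↔
    Feasible X st.cols cap st.rest.toFinset

theorem RemoveStep.trans {st₁ st₂ st₃ : Remaining n m} (h : RemoveStep X cap st₁ st₂)
    (h' : RemoveStep X cap st₂ st₃) : RemoveStep X cap st₁ st₃ :=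
  ⟨h'.wf, h'.size_le.trans h.size_le, fun c hc => h.cols_le c (h'.cols_le c hc),
    h'.feasible_iff.trans h.feasible_iff⟩

/-- The size never grows during a pass. If it is the same at the end, every colour was compared with
this very size, and the survivors have smaller capacity. A colour costs at most the loop step, three
operations for the test, one write and a filtering in `4 * st.size + 1`. -/
theorem removeDominated_spec (st : Remaining n m) (hst : st.WF) :
    RemoveStep X cap st (removeDominated X cap st).val ∧
    ((removeDominated X cap st).val.size = st.size →
      ∀ c, (removeDominated X cap st).val.cols c = true → cap c < st.size) ∧
    (removeDominated X cap st).time ≤ m * (4 * st.size + 6) + 1 := by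
  set body := fun (c' : Fin m) (st : Remaining n m) => (do
    let a ← op (st.cols c')
    let k ← op (cap c')
    let big ← op (decide ((st.size : ℤ) ≤ k))
    if a && big then do
      let cols ← op (Function.update st.cols c' false)
      let r ← without X c' st.rest
      pure ⟨cols, r.1, r.2⟩
    else pure st : Timed (Remaining n m)) with hbody
  have hrun : removeDominated X cap st = forEach (List.finRange m) st body := rfl
  rw [hrun]
  obtain ⟨t, ht, h1, h2, h3⟩ := forEach_invariant (fun p st' t => RemoveStep X cap st st' ∧
    (st'.size = st.size → ∀ c ∈ p, st'.cols c = true → cap c < st.size) ∧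
    t ≤ p.length * (4 * st.size + 6)) (List.finRange m) st body
    ⟨⟨hst, le_rfl, fun _ h => h, Iff.rfl⟩, by simp, by simp⟩ (by
      rintro p c r st' t - ⟨h1, h2, h3⟩
      have hlen : (p ++ [c]).length * (4 * st.size + 6) =
          p.length * (4 * st.size + 6) + (4 * st.size + 6) := by
        simp only [List.length_append, List.length_singleton]
        ring
      rw [hlen]
      have hsz := h1.size_le
      by_cases h : st'.cols c = true ∧ (st'.size : ℤ) ≤ cap c
      · have hval : (body c st').val = ⟨Function.update st'.cols c false,
            (without X c st'.rest).val.1, (without X c st'.rest).val.2⟩ := by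
          simp [hbody, h.1, h.2]
        have htime : (body c st').time = 4 + (without X c st'.rest).time := by
          simp [hbody, h.1, h.2]
          omega
        have hwt := without_time (X := X) c st'.rest
        rw [← h1.wf.2] at hwt
        rw [hval, htime]
        simp only [without_val]
        have hle : (st'.rest.filter fun k => !X k c).length ≤ st'.size := by
          rw [h1.wf.2]; exact List.length_filter_le _ _
        refine ⟨h1.trans ⟨⟨List.nodup_reverse.2 (h1.wf.1.filter _), by simp⟩, hle,
          fun c' => ?_, ?_⟩, fun (hs : (st'.rest.filter fun k => !X k c).length = st.size) c' hc' => ?_,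
          by omega⟩
        · simp only [Function.update_apply]
          split_ifs <;> simp
        · have hA : (st'.rest.toFinset.card : ℤ) ≤ cap c := by
            rw [List.toFinset_card_of_nodup h1.wf.1, ← h1.wf.2]
            exact h.2
          rw [← feasible_remove h.1 hA]
          have : (st'.rest.filter fun k => !X k c).reverse.toFinset =
              st'.rest.toFinset.filter fun k => X k c = false := by
            ext k; simp
          rw [this]
        · simp only [Function.update_apply]
          split_ifs with hcc
          · simp
          · intro hc''
            refine h2 (by omega) c' ?_ hc''
            simpa [hcc] using hc'
      · have hval : (body c st').val = st' := by
          change (if (st'.cols c && decide ((st'.size : ℤ) ≤ cap c)) = true then _ else pure st' :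
            Timed (Remaining n m)).val = st'
          rw [if_neg (by simpa using h)]
          rfl
        have htime : (body c st').time = 3 := by
          change 1 + (1 + (1 + (if (st'.cols c && decide ((st'.size : ℤ) ≤ cap c)) = true then _
            else pure st' : Timed (Remaining n m)).time)) = 3
          rw [if_neg (by simpa using h)]
          rfl
        rw [hval, htime]
        refine ⟨h1, fun hs c' hc' hc'' => ?_, by omega⟩
        rcases List.mem_append.1 hc' with hc' | hc'
        · exact h2 hs c' hc' hc''
        · rw [List.mem_singleton] at hc'
          subst hc'
          by_contra hlt
          exact h ⟨hc'', by omega⟩)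
  rw [List.length_finRange] at h3
  exact ⟨h1, fun hs c => h2 hs c (List.mem_finRange c), by omega⟩

/-- Every pass except the last lowers the size, so fuel exceeding the initial size suffices, and the
last pass certifies the bound on the capacities. -/
theorem removeAllDominated_spec (d fuel : ℕ) (st : Remaining n m) (hst : st.WF)
    (hfuel : st.size < fuel) (hd : st.size ≤ d) :
    RemoveStep X cap st (removeAllDominated X cap fuel st).val ∧
    (∀ c, (removeAllDominated X cap fuel st).val.cols c = true →
      cap c < (removeAllDominated X cap fuel st).val.size) ∧
    (removeAllDominated X cap fuel st).time ≤ fuel * (m * (4 * d + 6) + 2) := by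
  induction fuel generalizing st with
  | zero => omega
  | succ fuel ih =>
    obtain ⟨h1, h2, h3⟩ := removeDominated_spec (X := X) (cap := cap) st hst
    set st' := (removeDominated X cap st).val with hst'
    have h4 : m * (4 * st.size + 6) ≤ m * (4 * d + 6) := Nat.mul_le_mul_left _ (by omega)
    have h5 : (fuel + 1) * (m * (4 * d + 6) + 2) =
      fuel * (m * (4 * d + 6) + 2) + (m * (4 * d + 6) + 2) := by ring
    rw [h5]
    by_cases h : st'.size = st.size
    · have hval : (removeAllDominated X cap (fuel + 1) st).val = st' := by
        simp [removeAllDominated, ← hst', h]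
      have htime : (removeAllDominated X cap (fuel + 1) st).time =
          (removeDominated X cap st).time + 1 := by
        simp [removeAllDominated, ← hst', h]
      rw [hval, htime]
      exact ⟨h1, fun c hc => by rw [h]; exact h2 h c hc, by omega⟩
    · have hval : (removeAllDominated X cap (fuel + 1) st).val =
          (removeAllDominated X cap fuel st').val := by
        simp [removeAllDominated, ← hst', h]
      have htime : (removeAllDominated X cap (fuel + 1) st).time =
          (removeDominated X cap st).time + 1 + (removeAllDominated X cap fuel st').time := by
        simp [removeAllDominated, ← hst', h]
        omega
      have hsz := h1.size_le
      obtain ⟨k1, k2, k3⟩ := ih st' h1.wf (by omega) (by omega)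
      rw [hval, htime]
      exact ⟨h1.trans k1, k2, by omega⟩

/-- Colour `c` is a best response of a node with predecessors `A` to some colouring of `A`
by colours from the sets `X k`. -/
def Supported (G : CoordinationGame n m) (X : Fin n → Fin m → Bool) (i : Fin n)
    (A : Finset (Fin n)) (c : Fin m) : Prop :=
  ∃ f : Fin n → Fin m, (∀ k ∈ A, X k (f k) = true) ∧ ∀ c' ∈ G.C i,
    ((A.filter fun k => f k = c').card : ℤ) + G.β i c' ≤
      (A.filter fun k => f k = c).card + G.β i c

/-- The numbers of copies of the colours when `c` is tested. -/
def capacity (G : CoordinationGame n m) (i : Fin n) (c : Fin m) (s d : ℕ) (c' : Fin m) : ℤ :=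
  if c' ∈ G.C i then s + G.β i c - G.β i c' else d

/-- An exchange argument: recolouring with `c` every predecessor that admits `c` raises the count of
`c` to `|S|` and raises no other count. The best response inequality against an available `c'` then
says that at most `cap c'` nodes use `c'`. A colour outside `G.C i` gets capacity `|A|`, which never
binds. The sign condition mirrors the rejection test of the algorithm. -/
theorem supported_iff (G : CoordinationGame n m) (i : Fin n) (A : Finset (Fin n)) (c : Fin m)
    (cap : Fin m → ℤ)
    (hcap : cap = capacity G i c (A.filter fun k => X k c = true).card A.card) :
    Supported G X i A c ↔ (∀ c', c' ≠ c → 0 ≤ cap c') ∧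
      Feasible X (fun c' => decide (c' ≠ c)) cap (A.filter fun k => X k c = false) := by
  subst hcap
  constructor
  · rintro ⟨f, hf, hf'⟩
    have hS : (A.filter fun k => f k = c).card ≤ (A.filter fun k => X k c = true).card := by
      refine Finset.card_le_card fun k hk => ?_
      simp only [Finset.mem_filter] at hk ⊢
      exact ⟨hk.1, hk.2 ▸ hf k hk.1⟩
    have key : ∀ c', ((A.filter fun k => f k = c').card : ℤ) ≤
        capacity G i c (A.filter fun k => X k c = true).card A.card c' := by
      intro c'
      unfold capacity
      split_ifs with h
      · have := hf' c' h
        omega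
      · exact Int.ofNat_le.2 (Finset.card_filter_le _ _)
    refine ⟨fun c' _ => (Int.natCast_nonneg _).trans (key c'), f, fun k hk => ?_, fun c' _ => ?_⟩
    · have hk' := Finset.mem_filter.1 hk
      refine ⟨hf k hk'.1, ?_⟩
      have : f k ≠ c := by
        intro h
        have := hf k hk'.1
        rw [h, hk'.2] at this
        cases this
      simpa using this
    · exact (Int.ofNat_le.2 (Finset.card_le_card
        (Finset.filter_subset_filter _ (Finset.filter_subset _ _)))).trans (key c')
  · rintro ⟨-, g, hg, hg'⟩
    refine ⟨fun k => if X k c = true then c else g k, fun k hk => ?_, fun c' hc' => ?_⟩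
    · by_cases h : X k c = true
      · simp [h]
      · simpa [h] using (hg k (by simpa [hk] using h)).1
    · by_cases hcc : c' = c
      · rw [hcc]
      · have h1 : (A.filter fun k => X k c = true).card ≤
            (A.filter fun k => (if X k c = true then c else g k) = c).card := by
          refine Finset.card_le_card fun k hk => ?_
          simp only [Finset.mem_filter] at hk ⊢
          simp [hk.1, hk.2]
        have h2 : (A.filter fun k => (if X k c = true then c else g k) = c').card ≤
            ((A.filter fun k => X k c = false).filter fun k => g k = c').card := by
          refine Finset.card_le_card fun k hk => ?_
          simp only [Finset.mem_filter] at hk ⊢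
          obtain ⟨hk, hk'⟩ := hk
          split_ifs at hk' with h'
          · exact absurd hk'.symm hcc
          · exact ⟨⟨hk, by simpa using h'⟩, hk'⟩
        have h3 := hg' c' (by simpa using hcc)
        rw [capacity, if_pos hc'] at h3
        beta_reduce
        omega

/-- After the sign test the answer passes through three equivalences: the matching is complete iff
the reduced pair is feasible, iff the original pair is, iff `c` is supported. The removal stage also
yields the capacity bound on which the time of the matching stage rests. -/
theorem testColour_spec (G : CoordinationGame n m) (X : Fin n → Fin m → Bool) (i : Fin n)
    (Y : List (Fin n)) (hY : Y.Nodup) (c : Fin m) :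
    ((testColour G X i Y c).val = true ↔ Supported G X i Y.toFinset c) ∧
    (testColour G X i Y c).time ≤ 30 * (m + 1) * (Y.length + 1) ^ 2 := by
  have : Nonempty (Fin m) := ⟨c⟩
  set r := (without X c Y).val with hr
  set count := fun (_ : Fin n) (z : ℕ) => op (z + 1) with hcount
  have hd : (forEach Y 0 count).val = Y.length := by
    refine forEach_val_invariant (fun p z => z = p.length) Y 0 _ rfl ?_
    rintro p a r _ - rfl
    simp [hcount]
  have hdt : (forEach Y 0 count).time ≤ Y.length * 2 + 1 :=
    forEach_time_le' 1 Y 0 count fun _ _ _ => le_rfl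
  set A := Y.toFinset with hA
  have hAcard : A.card = Y.length := List.toFinset_card_of_nodup hY
  set s := Y.length - r.2 with hs
  have hr' : r = ((Y.filter fun k => !X k c).reverse, (Y.filter fun k => !X k c).length) :=
    without_val c Y
  have hrA : r.1.toFinset = A.filter fun k => X k c = false := by
    rw [hr']; ext k; simp [hA]
  have hr2 : r.2 = (A.filter fun k => X k c = false).card := by
    rw [← hrA, hr', List.toFinset_card_of_nodup (List.nodup_reverse.2 (hY.filter _))]
    simp
  have hsA : s = (A.filter fun k => X k c = true).card := by
    have := Finset.card_filter_add_card_filter_not (s := A) (fun k => X k c = true)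
    simp only [Bool.not_eq_true] at this
    omega
  set t : ℤ := (s : ℤ) + G.β i c with ht
  set initBody := fun (c' : Fin m) (p : (Fin m → Bool) × (Fin m → ℤ)) => (do
    let eq ← op (decide (c' = c))
    let cols ← op (Function.update p.1 c' (!eq))
    let inC ← op (decide (c' ∈ G.C i))
    let b' ← op (G.β i c')
    let k ← op (t - b')
    let cap ← op (Function.update p.2 c' (if inC then k else (Y.length : ℤ)))
    pure (cols, cap) : Timed ((Fin m → Bool) × (Fin m → ℤ))) with hinit
  set init := forEach (List.finRange m) ((fun _ => false, fun _ => 0) :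
    (Fin m → Bool) × (Fin m → ℤ)) initBody with hinit'
  have hinit_time : init.time ≤ m * 7 + 1 := by
    have := forEach_time_le' 6 (List.finRange m) ((fun _ => false, fun _ => 0) :
      (Fin m → Bool) × (Fin m → ℤ)) initBody fun _ _ _ => le_rfl
    simpa using this
  have hinit_val : init.val =
      (fun c' => decide (c' ≠ c), capacity G i c s Y.length) := by
    have := forEach_val_invariant (fun p (r : (Fin m → Bool) × (Fin m → ℤ)) => ∀ c' ∈ p,
      r.1 c' = decide (c' ≠ c) ∧ r.2 c' = capacity G i c s Y.length c') (List.finRange m)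
      (fun _ => false, fun _ => 0) initBody (by simp) (by
        rintro p a r st - h c' hc'
        by_cases hac : c' = a
        · subst hac
          simp [hinit, capacity, ht]
        · have := h c' (by simpa [hac] using hc')
          simpa [hinit, hac] using this)
    ext c'
    · exact (this c' (List.mem_finRange c')).1
    · exact (this c' (List.mem_finRange c')).2
  set cap := capacity G i c s Y.length with hcap
  set badBody := fun (p : (Fin m → Bool) × (Fin m → ℤ)) (c' : Fin m) (bad : Bool) => (do
    let a ← op (p.1 c')
    let k ← op (p.2 c')
    let neg ← op (decide (k < 0))
    pure (bad || (a && neg)) : Timed Bool) with hbadBody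
  set bad := forEach (List.finRange m) false (badBody init.val) with hbad
  have hbad_time : bad.time ≤ m * 4 + 1 := by
    have := forEach_time_le' 3 (List.finRange m) false (badBody init.val) fun _ _ _ => le_rfl
    simpa using this
  have hbv : ∀ a st, (badBody init.val a st).val =
      (st || (decide (a ≠ c) && decide (cap a < 0))) := by
    rw [hinit_val]
    exact fun _ _ => rfl
  have hbad_val : bad.val = true ↔ ∃ c', c' ≠ c ∧ cap c' < 0 := by
    have := forEach_val_invariant (fun p (b : Bool) => b = true ↔ ∃ c' ∈ p, c' ≠ c ∧ cap c' < 0)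
      (List.finRange m) false (badBody init.val) (by simp) (by
        rintro p a r st - h
        rw [hbv, Bool.or_eq_true, h]
        simp [or_and_right, exists_or])
    simpa using this
  set st₀ : Remaining n m := ⟨init.val.1, r.1, r.2⟩ with hst₀
  set rem := removeAllDominated X init.val.2 (r.2 + 1) st₀ with hrem
  set mm := maximumMatching X init.val.2 rem.val with hmm
  have hwf : st₀.WF := by
    rw [hst₀]
    refine ⟨?_, ?_⟩ <;> simp only [hr']
    · exact List.nodup_reverse.2 (hY.filter _)
    · simp
  have hr2le : r.2 ≤ Y.length := by
    rw [hr2, ← hAcard]; exact Finset.card_filter_le _ _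
  have hsupp := supported_iff G i A c cap (by rw [hcap, hsA, hAcard])
  have hwt := without_time (X := X) c Y
  have hval : (testColour G X i Y c).val =
      if bad.val then false else decide (mm.val = rem.val.size) := by
    simp only [testColour, bind_val, op_val, alloc_val, ← hr, ← hcount, hd, ← hs, ← ht, ← hinit,
      ← hinit']
    change (if bad.val = true then pure false else _ : Timed Bool).val = _
    cases bad.val <;> rfl
  have htime : (testColour G X i Y c).time = (without X c Y).time + (forEach Y 0 count).time +
      3 + 2 * m + init.time + bad.time +
      if bad.val then 0 else rem.time + mm.time + 1 := by
    simp only [testColour, bind_time, op_val, op_time, alloc_val, alloc_time, ← hr,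
      ← hcount, hd, ← hs, ← ht, ← hinit, ← hinit']
    change _ + (_ + (1 + (1 + (1 + (m + (m + (init.time + (bad.time +
      (if bad.val = true then pure false else _ : Timed Bool).time)))))))) = _
    cases bad.val with
    | true => simp; omega
    | false =>
      simp only [Bool.false_eq_true, if_false, bind_time, op_time]
      change _ + (_ + (1 + (1 + (1 + (m + (m + (init.time + (bad.time +
        (rem.time + (mm.time + 1)))))))))) = _
      omega
  by_cases hb : bad.val = true
  · rw [hval, htime, if_pos hb, if_pos hb, hsupp]
    refine ⟨?_, ?_⟩
    · obtain ⟨c', hc', hneg⟩ := hbad_val.1 hb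
      simp only [Bool.false_eq_true, false_iff]
      rintro ⟨h, -⟩
      have := h c' hc'
      omega
    · nlinarith [Nat.zero_le (m * Y.length), Nat.zero_le (m * Y.length * Y.length)]
  · have hnn : ∀ c', c' ≠ c → 0 ≤ cap c' := fun c' hc' => by
      by_contra h
      exact hb (hbad_val.2 ⟨c', hc', by omega⟩)
    obtain ⟨h1, h2, h3⟩ := removeAllDominated_spec (X := X) (cap := init.val.2) Y.length (r.2 + 1)
      st₀ hwf (Nat.lt_succ_self _) hr2le
    rw [← hrem] at h1 h2 h3
    have hcols : ∀ c', rem.val.cols c' = true → 0 ≤ init.val.2 c' := fun c' hc' => by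
      have := h1.cols_le c' hc'
      rw [hst₀, hinit_val] at this
      rw [hinit_val]
      exact hnn c' (by simpa using this)
    obtain ⟨k1, k2⟩ := maximumMatching_spec (X := X) (cap := init.val.2) rem.val h1.wf.1 h1.wf.2
      hcols h2
    rw [← hmm] at k1 k2
    have hsz : rem.val.size ≤ Y.length := h1.size_le.trans hr2le
    rw [hval, htime, if_neg hb, if_neg hb, hsupp, decide_eq_true_eq, k1, h1.feasible_iff]
    refine ⟨?_, ?_⟩
    · rw [hst₀, hinit_val]
      simp only [hrA]
      exact ⟨fun h => ⟨hnn, h⟩, fun h => h.2⟩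
    · have h4 : mm.time ≤ 9 * (m + 1) * (Y.length + 1) ^ 2 :=
        k2.trans (Nat.mul_le_mul_left _ (Nat.pow_le_pow_left (by omega) 2))
      have h5 : rem.time ≤ (Y.length + 1) * (m * (4 * Y.length + 6) + 2) :=
        h3.trans (Nat.mul_le_mul_right _ (by omega))
      nlinarith [Nat.zero_le (m * Y.length), Nat.zero_le (m * Y.length * Y.length)]

end TestColour

/-! ### Topological sorting and lists of predecessors -/

section Sorting

variable {n m : ℕ}

theorem wellFounded_edge {G : CoordinationGame n m} (hG : G.IsDAG) : WellFounded G.Edge := by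
  have : Std.Irrefl (Relation.TransGen G.Edge) := ⟨hG⟩
  exact Subrelation.wf (fun h => Relation.TransGen.single h)
    (Finite.wellFounded_of_trans_of_irrefl (Relation.TransGen G.Edge))

/-- The predecessors of every node in the list precede it. -/
def TopSorted (G : CoordinationGame n m) (l : List (Fin n)) : Prop :=
  ∀ p v r, l = p ++ v :: r → ∀ k, G.Edge k v → k ∈ p

/-- A finite acyclic graph is well-founded, so while nodes are left, some unplaced node has all its
predecessors placed. Hence no round is idle, and `n` rounds place every node. -/
theorem topologicalSort_spec (G : CoordinationGame n m) (hG : G.IsDAG) (L : List (Fin n × Fin n))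
    (hL : ∀ e, e ∈ L ↔ e ∈ G.E) :
    (topologicalSort L).val.Nodup ∧ (∀ v, v ∈ (topologicalSort L).val) ∧
    TopSorted G (topologicalSort L).val ∧
    (topologicalSort L).time ≤ n * (5 * n + 5 * L.length + 8) + 2 := by
  set blockBody := fun (placed : Fin n → Bool) (e : Fin n × Fin n) (b : Fin n → Bool) => (do
    let k ← op e.1
    let j ← op e.2
    let p ← op (placed k)
    if p then pure b else op (Function.update b j true) : Timed (Fin n → Bool)) with hblockBody
  set blocked := fun placed => forEach L (fun _ => false) (blockBody placed) with hblocked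
  set nextBody := fun (placed b : Fin n → Bool) (v : Fin n) (next : Option (Fin n)) => (do
    let p ← op (placed v)
    let b ← op (b v)
    if p || b then pure next else op (some v) : Timed (Option (Fin n))) with hnextBody
  set next := fun placed => forEach (List.finRange n) none
    (nextBody placed (blocked placed).val) with hnext
  set body := fun (_ : ℕ) (st : (Fin n → Bool) × List (Fin n)) => (do
    let blocked₀ ← alloc n fun _ : Fin n => false
    let blocked ← forEach L blocked₀ (blockBody st.1)
    let next ← forEach (List.finRange n) (none : Option (Fin n)) (nextBody st.1 blocked)
    match next with
    | none => pure st
    | some v => do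
      let placed ← op (Function.update st.1 v true)
      let l ← op (v :: st.2)
      pure (placed, l) : Timed ((Fin n → Bool) × List (Fin n))) with hbody
  set loop := forEach (List.range n) ((fun _ => false, []) : (Fin n → Bool) × List (Fin n)) body
    with hloop
  have hval : (topologicalSort L).val =
    (forEach loop.val.2 [] fun v l => op (v :: l)).val := rfl
  have htime : (topologicalSort L).time =
    n + (loop.time + (forEach loop.val.2 [] fun v l => op (v :: l)).time) := rfl
  have hrev : ∀ l : List (Fin n), (forEach l [] fun v l => op (v :: l)).val = l.reverse := by
    intro l
    refine forEach_val_invariant (fun p r => r = p.reverse) l [] _ rfl ?_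
    rintro p a r _ - rfl
    simp
  have hrevt : ∀ l : List (Fin n), (forEach l [] fun v l => op (v :: l)).time ≤
    l.length * 2 + 1 := fun l => forEach_time_le' 1 l [] _ fun _ _ _ => le_rfl
  have hblocked_val : ∀ placed j, (blocked placed).val j = true ↔
      ∃ k, G.Edge k j ∧ placed k = false := by
    intro placed j
    have := forEach_val_invariant (fun p (b : Fin n → Bool) => b j = true ↔
      ∃ k, (k, j) ∈ p ∧ placed k = false) L (fun _ => false) (blockBody placed) (by simp) (by
        rintro p ⟨k, j'⟩ r b - h
        cases hp : placed k with
        | true =>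
          have : (blockBody placed (k, j') b).val = b := by simp [hblockBody, hp]
          rw [this, h]
          refine exists_congr fun k' => and_congr_left fun hk' => ?_
          simp only [List.mem_append, List.mem_singleton, Prod.mk.injEq]
          constructor
          · exact Or.inl
          · rintro (h | ⟨rfl, -⟩)
            · exact h
            · rw [hp] at hk'; cases hk'
        | false =>
          have : (blockBody placed (k, j') b).val = Function.update b j' true := by
            simp [hblockBody, hp]
          rw [this, Function.update_apply]
          split_ifs with hj
          · subst hj
            simp only [true_iff]
            exact ⟨k, by simp, hp⟩
          · rw [h]
            simp [hj])
    rw [this]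
    simp only [hL]
    rfl
  have hblocked_time : ∀ placed, (blocked placed).time ≤ L.length * 5 + 1 := fun placed =>
    forEach_time_le' 4 L _ (blockBody placed) fun e _ b => by
      cases hp : placed e.1 <;> simp [hblockBody, hp]
  have hnext_val : ∀ placed, (∀ v, (next placed).val = some v →
      placed v = false ∧ (blocked placed).val v = false) ∧ ((next placed).val = none →
        ∀ v, placed v = true ∨ (blocked placed).val v = true) := by
    intro placed
    have := forEach_val_invariant (fun p (o : Option (Fin n)) => (∀ v, o = some v →
      placed v = false ∧ (blocked placed).val v = false) ∧ (o = none →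
        ∀ v ∈ p, placed v = true ∨ (blocked placed).val v = true)) (List.finRange n) none
      (nextBody placed (blocked placed).val) (by simp) (by
        rintro p v r o - ⟨h1, h2⟩
        by_cases h : placed v = true ∨ (blocked placed).val v = true
        · have : (nextBody placed (blocked placed).val v o).val = o := by simp [hnextBody, h]
          rw [this]
          refine ⟨h1, fun ho w hw => ?_⟩
          rcases List.mem_append.1 hw with hw | hw
          · exact h2 ho w hw
          · rw [List.mem_singleton] at hw
            exact hw ▸ h
        · have : (nextBody placed (blocked placed).val v o).val = some v := by
            simp [hnextBody, h]
          rw [this]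
          refine ⟨fun w hw => ?_, by simp⟩
          cases hw
          simpa using h)
    exact ⟨this.1, fun h v => this.2 h v (List.mem_finRange v)⟩
  have hnext_time : ∀ placed, (next placed).time ≤ n * 4 + 1 := fun placed => by
    have := forEach_time_le' 3 (List.finRange n) none (nextBody placed (blocked placed).val)
      fun v _ o => by
        by_cases h : placed v = true ∨ (blocked placed).val v = true <;> simp [hnextBody, h]
    simpa using this
  have hbody_time : ∀ j st, (body j st).time ≤ 5 * n + 5 * L.length + 4 := by
    intro j st
    have h1 := hblocked_time st.1
    have h2 := hnext_time st.1
    have h3 : (body j st).time = n + ((blocked st.1).time + ((next st.1).time +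
      (match (next st.1).val with
        | none => pure st
        | some v => do
          let placed ← op (Function.update st.1 v true)
          let l ← op (v :: st.2)
          pure (placed, l) : Timed ((Fin n → Bool) × List (Fin n))).time)) := rfl
    rw [h3]
    cases (next st.1).val with
    | none => simp only [pure_time]; omega
    | some v => simp only [bind_time, op_time, pure_time]; omega
  have hmain := forEach_val_invariant (fun p (st : (Fin n → Bool) × List (Fin n)) =>
      st.2.Nodup ∧ (∀ v, st.1 v = true ↔ v ∈ st.2) ∧
      -- The list grows at its head, so predecessors stand behind `v` until the final reversal.
      (∀ p v s, st.2 = p ++ v :: s → ∀ k, G.Edge k v → k ∈ s) ∧ st.2.length = p.length)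
      (List.range n) (fun _ => false, []) body (by simp) (by
    rintro p j r ⟨placed, l⟩ hl ⟨h1, h2, h3, h4⟩
    simp only at h1 h2 h3 h4
    have hlt : l.length < n := by
      have := congrArg List.length hl
      simp only [List.length_range, List.length_append, List.length_cons] at this
      omega
    obtain ⟨v₀, hv₀⟩ : ∃ v, v ∉ l := by
      by_contra hall
      push Not at hall
      have := List.Nodup.length_le_card h1
      have h5 : (Finset.univ : Finset (Fin n)) ⊆ l.toFinset := fun v _ =>
        List.mem_toFinset.2 (hall v)
      have h6 := Finset.card_le_card h5
      have h7 := List.toFinset_card_le l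
      rw [Finset.card_univ, Fintype.card_fin] at h6
      omega
    obtain ⟨u, hu, hmin⟩ := (wellFounded_edge hG).has_min {v | v ∉ l} ⟨v₀, hv₀⟩
    have hu' : ¬ (placed u = true ∨ (blocked placed).val u = true) := by
      rintro (h | h)
      · exact hu ((h2 u).1 h)
      · obtain ⟨k, hk, hk'⟩ := (hblocked_val placed u).1 h
        refine hmin k (fun hkl => ?_) hk
        rw [(h2 k).2 hkl] at hk'
        cases hk'
    obtain ⟨n1, n2⟩ := hnext_val placed
    have hb : (body j (placed, l)).val = (match (next placed).val with
        | none => pure (placed, l)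
        | some v => do
          let placed ← op (Function.update placed v true)
          let l ← op (v :: l)
          pure (placed, l) : Timed ((Fin n → Bool) × List (Fin n))).val := rfl
    cases hnx : (next placed).val with
    | none => exact absurd (n2 hnx u) hu'
    | some v =>
      rw [hnx] at hb
      obtain ⟨hv1, hv2⟩ := n1 v hnx
      rw [hb]
      simp only [bind_val, op_val, pure_val]
      have hvl : v ∉ l := fun h => by rw [(h2 v).2 h] at hv1; cases hv1
      refine ⟨List.nodup_cons.2 ⟨hvl, h1⟩, fun w => ?_, fun p' w s' heq k hk => ?_, by simp [h4]⟩
      · rw [Function.update_apply]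
        split_ifs with hw
        · simp [hw]
        · simp [h2, hw]
      · cases p' with
        | nil =>
          simp only [List.nil_append, List.cons.injEq] at heq
          obtain ⟨rfl, rfl⟩ := heq
          rw [← h2]
          by_contra hk'
          have := (hblocked_val placed v).2 ⟨k, hk, by simpa using hk'⟩
          rw [hv2] at this
          cases this
        | cons a p' =>
          simp only [List.cons_append, List.cons.injEq] at heq
          exact h3 p' w s' heq.2 k hk)
  rw [← hloop] at hmain
  obtain ⟨h1, h2, h3, h4⟩ := hmain
  rw [List.length_range] at h4
  refine ⟨?_, fun v => ?_, fun p v r heq k hk => ?_, ?_⟩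
  · rw [hval, hrev]
    exact List.nodup_reverse.2 h1
  · rw [hval, hrev, List.mem_reverse, ← List.mem_toFinset]
    have : loop.val.2.toFinset = Finset.univ := by
      rw [← Finset.card_eq_iff_eq_univ, List.toFinset_card_of_nodup h1, h4, Fintype.card_fin]
    rw [this]
    exact Finset.mem_univ v
  · rw [hval, hrev, List.reverse_eq_iff] at heq
    have := h3 r.reverse v p.reverse (by simp [heq]) k hk
    simpa using this
  · have h5 : loop.time ≤ n * (5 * n + 5 * L.length + 4 + 1) + 1 := by
      have := forEach_time_le' (5 * n + 5 * L.length + 4) (List.range n)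
        ((fun _ => false, []) : (Fin n → Bool) × List (Fin n)) body fun j _ st => hbody_time j st
      simpa using this
    have h6 := hrevt loop.val.2
    rw [h4] at h6
    rw [htime]
    nlinarith

theorem predecessorLists_spec (G : CoordinationGame n m) (L : List (Fin n × Fin n))
    (hnd : L.Nodup) (hL : ∀ e, e ∈ L ↔ e ∈ G.E) :
    (∀ i, ((predecessorLists L).val i).Nodup ∧
      ((predecessorLists L).val i).toFinset = G.predecessors i) ∧
    (predecessorLists L).time ≤ n + 6 * L.length + 1 := by
  set body := fun (e : Fin n × Fin n) (N : Fin n → List (Fin n)) => (do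
    let k ← op e.1
    let j ← op e.2
    let l ← op (N j)
    let l' ← op (k :: l)
    op (Function.update N j l') : Timed (Fin n → List (Fin n))) with hbody
  have hval : (predecessorLists L).val = (forEach L (fun _ => []) body).val := rfl
  have htime : (predecessorLists L).time = n + (forEach L (fun _ => []) body).time := rfl
  refine ⟨?_, ?_⟩
  · have := forEach_val_invariant (fun p (N : Fin n → List (Fin n)) =>
      ∀ i, (N i).Nodup ∧ ∀ k, k ∈ N i ↔ (k, i) ∈ p) L (fun _ => []) body (by simp) (by
        rintro p ⟨k, j⟩ r N hl h i
        have hb : (body (k, j) N).val = Function.update N j (k :: N j) := rfl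
        rw [hb, Function.update_apply]
        have hkj : (k, j) ∉ p := by
          intro hmem
          rw [hl, List.nodup_append] at hnd
          exact hnd.2.2 _ hmem _ (by simp) rfl
        split_ifs with hij
        · subst hij
          refine ⟨List.nodup_cons.2 ⟨fun h' => hkj (((h i).2 k).1 h'), (h i).1⟩, fun k' => ?_⟩
          rw [List.mem_cons, (h i).2]
          simp [or_comm]
        · refine ⟨(h i).1, fun k' => ?_⟩
          rw [(h i).2]
          simp [hij])
    intro i
    rw [hval]
    refine ⟨(this i).1, ?_⟩
    ext k
    rw [List.mem_toFinset, (this i).2, hL]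
    simp [CoordinationGame.predecessors]
  · have := forEach_time_le' 5 L (fun _ => []) body fun _ _ _ => le_rfl
    rw [htime]
    omega

end Sorting

/-! ### The processing of a node -/

section ProcessNode

variable {n m : ℕ}

theorem supported_congr (G : CoordinationGame n m) {X X' : Fin n → Fin m → Bool} (i : Fin n)
    {A : Finset (Fin n)} (h : ∀ k ∈ A, X k = X' k) (c : Fin m) :
    Supported G X i A c ↔ Supported G X' i A c := by
  refine exists_congr fun f => and_congr_left fun _ => forall₂_congr fun k hk => ?_
  rw [h k hk]

/-- The set `X i` is the one the algorithm has to compute from the sets of the predecessors. -/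
def LocallyCorrect (G : CoordinationGame n m) (q : Fin n → Option (Fin m))
    (X : Fin n → Fin m → Bool) (i : Fin n) : Prop :=
  (∀ c, X i c = true ↔ c ∈ G.C i ∧ Supported G X i (G.predecessors i) c ∧
    ∀ d, q i = some d → c = d) ∧ ∀ d, q i = some d → X i d = true

theorem locallyCorrect_congr (G : CoordinationGame n m) (q : Fin n → Option (Fin m))
    {X X' : Fin n → Fin m → Bool} (i : Fin n) (h : ∀ k ∈ G.predecessors i, X k = X' k)
    (hi : X i = X' i) : LocallyCorrect G q X i ↔ LocallyCorrect G q X' i := by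
  simp only [LocallyCorrect, hi, supported_congr G i h]

/-- A node is not its own predecessor, so writing into `X i` between the tests does not influence
them. The time is bounded by a square in order to be summed over the nodes as the square of a sum.
-/
theorem processNode_spec (G : CoordinationGame n m) (q : Fin n → Option (Fin m))
    (N : Fin n → List (Fin n)) (i : Fin n) (X : Fin n → Fin m → Bool) (hnd : (N i).Nodup)
    (hN : (N i).toFinset = G.predecessors i) (hq : ∀ c, q i = some c → c ∈ G.C i) :
    (∀ k, k ≠ i → (processNode G q N i X).val.X k = X k) ∧
    ((processNode G q N i X).val.answer = true →
      LocallyCorrect G q (processNode G q N i X).val.X i) ∧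
    ((processNode G q N i X).val.answer = false →
      ∃ d, q i = some d ∧ ¬ Supported G X i (G.predecessors i) d) ∧
    (processNode G q N i X).time ≤ 37 * ((m + 1) * (G.predecessors i).card.succ) ^ 2 := by
  set clear := fun X : Fin n → Fin m → Bool =>
    forEach (List.finRange m) X fun c X => op (write₂ X i c false) with hclear
  set body := fun (c : Fin m) (X : Fin n → Fin m → Bool) => (do
    let inC ← op (decide (c ∈ G.C i))
    if inC then do
      let ok ← testColour G X i (N i) c
      if ok then op (write₂ X i c true) else pure X
    else pure X : Timed (Fin n → Fin m → Bool)) with hbody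
  have hii : i ∉ G.predecessors i := by
    simp [CoordinationGame.predecessors, G.loopless i]
  have hclear_val : ∀ X k c, (clear X).val k c = if k = i then false else X k c := by
    intro X k c
    have := forEach_val_invariant (fun p X' => (∀ c ∈ p, X' i c = false) ∧
      ∀ k ≠ i, X' k = X k) (List.finRange m) X (fun c X => op (write₂ X i c false)) (by simp) (by
        rintro p a r X' - ⟨h1, h2⟩
        simp only [op_val]
        refine ⟨fun c hc => ?_, fun k hk => ?_⟩
        · rw [write₂_apply]
          split_ifs with h
          · rfl
          · exact h1 c (by simpa [show c ≠ a by simpa using h] using hc)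
        · rw [← h2 k hk]
          ext c
          simp [write₂_apply, hk])
    split_ifs with hk
    · subst hk
      exact this.1 c (List.mem_finRange c)
    · exact congrFun (this.2 k hk) c
  have hclear_time : ∀ X, (clear X).time ≤ m * 2 + 1 := fun X => by
    have := forEach_time_le' 1 (List.finRange m) X (fun c X => op (write₂ X i c false))
      fun _ _ _ => le_rfl
    simpa using this
  set loop := forEach (List.finRange m) (clear X).val body with hloop
  have hd : (N i).length = (G.predecessors i).card := by
    rw [← hN, List.toFinset_card_of_nodup hnd]
  have hloop_val : (∀ k ≠ i, loop.val k = X k) ∧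
      ∀ c, loop.val i c = true ↔ c ∈ G.C i ∧ Supported G X i (G.predecessors i) c := by
    have := forEach_val_invariant (fun p X' => (∀ k ≠ i, X' k = X k) ∧
      ∀ c, X' i c = true ↔ c ∈ p ∧ c ∈ G.C i ∧ Supported G X i (G.predecessors i) c)
      (List.finRange m) (clear X).val body
      ⟨fun k hk => by ext c; simp [hclear_val, hk], by simp [hclear_val]⟩ (by
        rintro p a r X' hl ⟨h1, h2⟩
        have hap : a ∉ p := by
          intro hap
          have := List.nodup_finRange m
          rw [hl, List.nodup_append] at this
          exact this.2.2 _ hap _ (by simp) rfl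
        have hsupp : (testColour G X' i (N i) a).val = true ↔
            Supported G X i (G.predecessors i) a := by
          rw [(testColour_spec G X' i (N i) hnd a).1, hN]
          exact supported_congr G i (fun k hk => h1 k (by rintro rfl; exact hii hk)) a
        by_cases h : a ∈ G.C i ∧ (testColour G X' i (N i) a).val = true
        · have hb : (body a X').val = write₂ X' i a true := by simp [hbody, h.1, h.2]
          rw [hb]
          refine ⟨fun k hk => ?_, fun c => ?_⟩
          · rw [← h1 k hk]
            ext c
            simp [write₂_apply, hk]
          · rw [write₂_apply]
            split_ifs with hc
            · simp [hc.2, h.1, hsupp.1 h.2]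
            · have : c ≠ a := by simpa using hc
              simp [h2, this]
        · have hb : (body a X').val = X' := by
            by_cases h' : a ∈ G.C i
            · simp [hbody, h', show (testColour G X' i (N i) a).val = false by simpa [h'] using h]
            · simp [hbody, h']
          rw [hb]
          refine ⟨h1, fun c => ?_⟩
          rw [h2]
          by_cases hc : c = a
          · subst hc
            rw [hsupp] at h
            simp [h]
          · simp [hc])
    simpa using this
  have hloop_time : loop.time ≤ m * (30 * (m + 1) * ((N i).length + 1) ^ 2 + 3) + 1 := by
    have := forEach_time_le' (30 * (m + 1) * ((N i).length + 1) ^ 2 + 2) (List.finRange m)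
      (clear X).val body fun c _ X' => by
        have := (testColour_spec G X' i (N i) hnd c).2
        by_cases h' : c ∈ G.C i
        · cases h : (testColour G X' i (N i) c).val <;> simp [hbody, h', h] <;> omega
        · simp [hbody, h']
    simpa using this
  have hrun : (processNode G q N i X).val = (match q i with
      | none => pure ⟨true, loop.val⟩
      | some d => do
        let ok ← op (loop.val i d)
        if ok then do
          let X ← clear loop.val
          let X ← op (write₂ X i d true)
          pure ⟨true, X⟩
        else pure ⟨false, loop.val⟩ : Timed (Outcome n m)).val := rfl
  have hrunt : (processNode G q N i X).time = (clear X).time + (1 + (loop.time + (1 +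
      (match q i with
      | none => pure ⟨true, loop.val⟩
      | some d => do
        let ok ← op (loop.val i d)
        if ok then do
          let X ← clear loop.val
          let X ← op (write₂ X i d true)
          pure ⟨true, X⟩
        else pure ⟨false, loop.val⟩ : Timed (Outcome n m)).time))) := rfl
  obtain ⟨l1, l2⟩ := hloop_val
  -- The colour tests contribute the 30; loop steps, clearing twice and the query add `7 * (m + 1)`.
  have hbound : m * (30 * (m + 1) * ((N i).length + 1) ^ 2 + 3) + 4 * m + 7 ≤
      37 * ((m + 1) * (G.predecessors i).card.succ) ^ 2 := by
    rw [← hd, Nat.succ_eq_add_one]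
    have h1 : 1 ≤ ((N i).length + 1) ^ 2 := Nat.one_le_pow _ _ (Nat.succ_pos _)
    have h2 : 30 * (m * (m + 1) * ((N i).length + 1) ^ 2) + 7 * m + 7 ≤
        37 * ((m + 1) ^ 2 * ((N i).length + 1) ^ 2) := by nlinarith
    calc _ = 30 * (m * (m + 1) * ((N i).length + 1) ^ 2) + 7 * m + 7 := by ring
      _ ≤ _ := h2
      _ = _ := by ring
  have hc1 := hclear_time X
  have hc2 := hclear_time loop.val
  have hpred : ∀ X' : Fin n → Fin m → Bool, (∀ k ≠ i, X' k = X k) →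
      ∀ c, Supported G X' i (G.predecessors i) c ↔ Supported G X i (G.predecessors i) c :=
    fun X' h c => supported_congr G i (fun k hk => h k (by rintro rfl; exact hii hk)) c
  cases hqi : q i with
  | none =>
    simp only [hqi, pure_val, pure_time] at hrun hrunt
    rw [hrun, hrunt]
    refine ⟨l1, fun _ => ⟨fun c => ?_, by simp [hqi]⟩, by simp, by omega⟩
    simp only [l2, hpred _ l1]
    simp [hqi]
  | some d =>
    cases hok : loop.val i d with
    | false =>
      simp only [hqi, bind_val, op_val, bind_time, op_time, hok, Bool.false_eq_true, if_false,
        pure_val, pure_time] at hrun hrunt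
      rw [hrun, hrunt]
      refine ⟨l1, by simp, fun _ => ⟨d, rfl, fun h => ?_⟩, by omega⟩
      rw [(l2 d).2 ⟨hq d hqi, h⟩] at hok
      cases hok
    | true =>
      simp only [hqi, bind_val, op_val, bind_time, op_time, hok, if_true, pure_val,
        pure_time] at hrun hrunt
      rw [hrun, hrunt]
      have hX : ∀ k ≠ i, write₂ (clear loop.val).val i d true k = X k := by
        intro k hk
        rw [← l1 k hk]
        ext c
        simp [write₂_apply, hclear_val, hk]
      refine ⟨hX, fun _ => ⟨fun c => ?_, ?_⟩, by simp, by omega⟩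
      · simp only [hpred _ hX, hqi]
        by_cases hc : c = d
        · subst hc
          simp [write₂_apply, (l2 c).1 hok]
        · simp [write₂_apply, hclear_val, hc]
      · simp [write₂_apply, hqi]

end ProcessNode

/-! ### Nash equilibria of games on acyclic graphs -/

section Equilibria

variable {n m : ℕ} (G : CoordinationGame n m)

/-- The colour of `i` maximises the payoff of `i` given the colours of its predecessors. -/
def BestResponse (s : Fin n → Fin m) (i : Fin n) : Prop :=
  ∀ c' ∈ G.C i, (((G.predecessors i).filter fun k => s k = c').card : ℤ) + G.β i c' ≤
    ((G.predecessors i).filter fun k => s k = s i).card + G.β i (s i)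

variable {G}

theorem mem_predecessors {i k : Fin n} : k ∈ G.predecessors i ↔ G.Edge k i := by
  simp [CoordinationGame.predecessors, CoordinationGame.Edge]

/-- Without loops a deviation of `i` does not touch its predecessors, so both payoffs count colours
in the same colouring. They are integers, which permits the comparison over `ℤ`. -/
theorem isNE_iff (s : G.JointStrategy) : G.IsNE s ↔ ∀ i, BestResponse G (fun i => (s i).1) i := by
  have hpay : ∀ (i : Fin n) (x : {c : Fin m // c ∈ G.C i}),
      G.toStrategicGame.payoff i (Function.update s i x) =
        (((G.predecessors i).filter fun j => (s j).1 = x.1).card : ℝ) + (G.β i x.1 : ℝ) := by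
    intro i x
    change (((G.predecessors i).filter fun j =>
      (Function.update s i x i).1 = (Function.update s i x j).1).card : ℝ) +
        (G.β i (Function.update s i x i).1 : ℝ) = _
    simp only [Function.update_self]
    congr 3
    refine Finset.filter_congr fun j hj => ?_
    have hji : j ≠ i := by
      rintro rfl
      exact G.loopless j (mem_predecessors.1 hj)
    rw [Function.update_of_ne hji, eq_comm]
  have hpay' : ∀ i : Fin n, G.toStrategicGame.payoff i s =
      (((G.predecessors i).filter fun j => (s j).1 = (s i).1).card : ℝ) + (G.β i (s i).1 : ℝ) := by
    intro i
    change (((G.predecessors i).filter fun j => (s i).1 = (s j).1).card : ℝ) +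
      (G.β i (s i).1 : ℝ) = _
    simp only [eq_comm]
  refine forall_congr' fun i => ?_
  constructor
  · intro h c' hc'
    have := h ⟨c', hc'⟩
    rw [hpay', hpay i ⟨c', hc'⟩, not_lt] at this
    exact_mod_cast this
  · intro h x
    rw [hpay', hpay i x, not_lt]
    have := h x.1 x.2
    exact_mod_cast this

theorem bestResponse_congr {s s' : Fin n → Fin m} {i : Fin n} (hi : s i = s' i)
    (h : ∀ k, G.Edge k i → s k = s' k) : BestResponse G s i ↔ BestResponse G s' i := by
  have : ∀ c, ((G.predecessors i).filter fun k => s k = c) =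
      ((G.predecessors i).filter fun k => s' k = c) := fun c =>
    Finset.filter_congr fun k hk => by rw [h k (mem_predecessors.1 hk)]
  simp only [BestResponse, this, hi]

/-- There is a best response to every colouring of the predecessors. -/
theorem exists_bestResponse (s : Fin n → Fin m) (i : Fin n) :
    ∃ c ∈ G.C i, ∀ c' ∈ G.C i,
      (((G.predecessors i).filter fun k => s k = c').card : ℤ) + G.β i c' ≤
        ((G.predecessors i).filter fun k => s k = c).card + G.β i c :=
  Finset.exists_max_image (G.C i)
    (fun c => (((G.predecessors i).filter fun k => s k = c).card : ℤ) + G.β i c) (G.C_nonempty i)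

theorem bestResponse_update {s : Fin n → Fin m} {i : Fin n} {c : Fin m}
    (h : ∀ c' ∈ G.C i, (((G.predecessors i).filter fun k => s k = c').card : ℤ) + G.β i c' ≤
        ((G.predecessors i).filter fun k => s k = c).card + G.β i c) :
    BestResponse G (Function.update s i c) i := by
  have : ∀ c', ((G.predecessors i).filter fun k => Function.update s i c k = c') =
      ((G.predecessors i).filter fun k => s k = c') := fun c' =>
    Finset.filter_congr fun k hk => by
      have : k ≠ i := by rintro rfl; exact G.loopless k (mem_predecessors.1 hk)
      rw [Function.update_of_ne this]
  simpa only [BestResponse, this, Function.update_self] using h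

theorem bestResponse_update_of_not_edge {s : Fin n → Fin m} {i j : Fin n} {c : Fin m}
    (hji : j ≠ i) (hij : ¬ G.Edge i j) :
    BestResponse G (Function.update s i c) j ↔ BestResponse G s j :=
  bestResponse_congr (Function.update_of_ne hji _ _) fun k hk =>
    Function.update_of_ne (by rintro rfl; exact hij hk) _ _

/-- A set of nodes that contains the predecessors of its elements. -/
def AncestorClosed (G : CoordinationGame n m) (P : Finset (Fin n)) : Prop :=
  ∀ i ∈ P, ∀ k, G.Edge k i → k ∈ P

/-- An equilibrium on an ancestor-closed set extends to the whole graph. -/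
theorem exists_extension (hG : G.IsDAG) (P : Finset (Fin n)) (hP : AncestorClosed G P)
    (s : Fin n → Fin m) (hs : ∀ i, s i ∈ G.C i) (hbr : ∀ i ∈ P, BestResponse G s i) :
    ∃ s' : G.JointStrategy, G.IsNE s' ∧ ∀ i ∈ P, (s' i).1 = s i := by
  induction hk : Pᶜ.card generalizing P s with
  | zero =>
    have hall : ∀ i, i ∈ P := fun i => by
      rw [Finset.card_eq_zero, Finset.compl_eq_empty_iff] at hk
      rw [hk]; exact Finset.mem_univ i
    exact ⟨fun i => ⟨s i, hs i⟩, (isNE_iff _).2 fun i => hbr i (hall i), fun _ _ => rfl⟩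
  | succ k ih =>
    have hne : (Pᶜ).Nonempty := Finset.card_pos.1 (by omega)
    obtain ⟨v₀, hv₀⟩ := hne
    -- A minimal node outside `P` has all its predecessors in `P` and can answer them by a best
    -- response. It precedes no node of `P`, since `P` is ancestor-closed, so nothing settled is
    -- disturbed.
    obtain ⟨i, hi, hmin⟩ := (wellFounded_edge hG).has_min {v | v ∉ P}
      ⟨v₀, by simpa using hv₀⟩
    have hi' : i ∉ P := hi
    obtain ⟨c, hc, hmax⟩ := exists_bestResponse (G := G) s i
    have hpred : ∀ k, G.Edge k i → k ∈ P := fun k hk => by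
      by_contra h
      exact hmin k h hk
    obtain ⟨s', h1, h2⟩ := ih (insert i P) (by
        intro j hj k hk
        rcases Finset.mem_insert.1 hj with rfl | hj
        · exact Finset.mem_insert_of_mem (hpred k hk)
        · exact Finset.mem_insert_of_mem (hP j hj k hk))
      (Function.update s i c) (fun j => by
        rw [Function.update_apply]; split_ifs with h
        · rw [h]; exact hc
        · exact hs j)
      (fun j hj => by
        rcases Finset.mem_insert.1 hj with rfl | hj'
        · exact bestResponse_update hmax
        · have hji : j ≠ i := by rintro rfl; exact hi' hj'
          exact (bestResponse_update_of_not_edge hji fun h => hi' (hP j hj' i h)).2 (hbr j hj'))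
      (by
        have := Finset.card_compl_add_card (insert i P)
        have h3 := Finset.card_compl_add_card P
        rw [Finset.card_insert_of_notMem hi'] at this
        omega)
    refine ⟨s', h1, fun j hj => ?_⟩
    rw [h2 j (Finset.mem_insert_of_mem hj), Function.update_of_ne]
    rintro rfl
    exact hi' hj

variable {q : Fin n → Option (Fin m)} {X : Fin n → Fin m → Bool}

/-- The sets `X i` contain the colours of the equilibria that are consistent with the query. -/
theorem mem_of_bestResponse (hG : G.IsDAG) (P : Finset (Fin n)) (hP : AncestorClosed G P)
    (hX : ∀ i ∈ P, LocallyCorrect G q X i) (s : Fin n → Fin m) (hs : ∀ i, s i ∈ G.C i)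
    (hbr : ∀ i ∈ P, BestResponse G s i) (hq : ∀ i ∈ P, ∀ d, q i = some d → s i = d) :
    ∀ i ∈ P, X i (s i) = true := by
  intro i
  induction i using (wellFounded_edge hG).induction with
  | _ i ih =>
    intro hi
    -- The colouring `s` itself serves as the supporting colouring of the predecessors.
    exact ((hX i hi).1 (s i)).2 ⟨hs i, ⟨s, fun k hk =>
      ih k (mem_predecessors.1 hk) (hP i hi k (mem_predecessors.1 hk)), hbr i hi⟩, hq i hi⟩

/-- The sets `X i` are non-empty. -/
theorem exists_mem (hG : G.IsDAG) (P : Finset (Fin n)) (hP : AncestorClosed G P)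
    (hX : ∀ i ∈ P, LocallyCorrect G q X i) : ∀ i ∈ P, ∃ c, X i c = true := by
  intro i
  induction i using (wellFounded_edge hG).induction with
  | _ i ih =>
    intro hi
    cases hqi : q i with
    | some d => exact ⟨d, (hX i hi).2 d hqi⟩
    | none =>
      -- Any choice of colours from the predecessors' sets has a best response, which is then
      -- supported. Elsewhere an arbitrary colour makes the choice total.
      have : ∀ k, ∃ c, k ∈ G.predecessors i → X k c = true := fun k => by
        by_cases hk : k ∈ G.predecessors i
        · obtain ⟨c, hc⟩ := ih k (mem_predecessors.1 hk) (hP i hi k (mem_predecessors.1 hk))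
          exact ⟨c, fun _ => hc⟩
        · exact ⟨(G.C_nonempty i).choose, fun h => absurd h hk⟩
      choose f hf using this
      obtain ⟨c, hc, hmax⟩ := exists_bestResponse (G := G) f i
      exact ⟨c, ((hX i hi).1 c).2 ⟨hc, ⟨f, fun k hk => hf k hk, hmax⟩, by simp [hqi]⟩⟩

/-- Colours from the sets `X i` of nodes without successors in `P` are attained simultaneously in
an equilibrium on `P` that is consistent with the query. -/
theorem exists_bestResponse_on (hG : G.IsDAG) (hout : G.OutDegreeAtMostOne) (P : Finset (Fin n))
    (hP : AncestorClosed G P) (hX : ∀ i ∈ P, LocallyCorrect G q X i) (t : Fin n → Fin m)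
    (ht : ∀ i ∈ P, X i (t i) = true) :
    ∃ s : Fin n → Fin m, (∀ i, s i ∈ G.C i) ∧ (∀ i ∈ P, BestResponse G s i) ∧
      (∀ i ∈ P, ∀ d, q i = some d → s i = d) ∧
      ∀ k ∈ P, (∀ j ∈ P, ¬ G.Edge k j) → s k = t k := by
  induction hk : P.card generalizing P t with
  | zero =>
    rw [Finset.card_eq_zero] at hk
    subst hk
    exact ⟨fun i => (G.C_nonempty i).choose, fun i => (G.C_nonempty i).choose_spec, by simp,
      by simp, by simp⟩
  | succ k ih =>
    have hwf : WellFounded (Function.swap G.Edge) := by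
      have : Std.Irrefl (Relation.TransGen (Function.swap G.Edge)) :=
        ⟨fun a h => hG a (Relation.transGen_swap.1 h)⟩
      exact Subrelation.wf (fun h => Relation.TransGen.single h)
        (Finite.wellFounded_of_trans_of_irrefl (Relation.TransGen (Function.swap G.Edge)))
    obtain ⟨v₀, hv₀⟩ : P.Nonempty := Finset.card_pos.1 (by omega)
    -- A sink `i` of `P` is peeled off, and the colours `f` that support `t i` become the targets
    -- prescribed at its predecessors.
    obtain ⟨i, hi, hmax⟩ := hwf.has_min {v | v ∈ P} ⟨v₀, hv₀⟩
    have hi' : i ∈ P := hi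
    have hsink : ∀ j ∈ P, ¬ G.Edge i j := fun j hj => hmax j hj
    obtain ⟨htC, ⟨f, hf, hfmax⟩, htq⟩ := ((hX i hi').1 (t i)).1 (ht i hi')
    obtain ⟨s, h1, h2, h3, h4⟩ := ih (P.erase i)
      (fun j hj k hk => Finset.mem_erase.2
        ⟨by rintro rfl; exact hsink j (Finset.mem_of_mem_erase hj) hk,
          hP j (Finset.mem_of_mem_erase hj) k hk⟩)
      (fun j hj => hX j (Finset.mem_of_mem_erase hj))
      (fun k => if k ∈ G.predecessors i then f k else t k)
      (fun k hk => by
        split_ifs with h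
        · exact hf k h
        · exact ht k (Finset.mem_of_mem_erase hk))
      (by rw [Finset.card_erase_of_mem hi']; omega)
    have hsf : ∀ k ∈ G.predecessors i, s k = f k := by
      intro k hk
      have hke := mem_predecessors.1 hk
      have hki : k ≠ i := by rintro rfl; exact G.loopless k hke
      -- Out-degree at most one enters here: the only edge out of `k` leads to `i`, so `k` is a sink
      -- once `i` is erased. The induction hypothesis thus realises `f` at all predecessors
      -- simultaneously.
      have := h4 k (Finset.mem_erase.2 ⟨hki, hP i hi' k hke⟩) (fun j hj hkj => by
        have hj' : j ∈ G.successors k := Finset.mem_filter.2 ⟨Finset.mem_univ j, hkj⟩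
        have hi'' : i ∈ G.successors k := Finset.mem_filter.2 ⟨Finset.mem_univ i, hke⟩
        exact (Finset.mem_erase.1 hj).1 (Finset.card_le_one.1 (hout k) j hj' i hi''))
      rwa [if_pos hk] at this
    refine ⟨Function.update s i (t i), fun j => ?_, fun j hj => ?_, fun j hj d hd => ?_,
      fun k hk hk' => ?_⟩
    · rw [Function.update_apply]
      split_ifs with h
      · rw [h]; exact htC
      · exact h1 j
    · by_cases hji : j = i
      · subst hji
        refine bestResponse_update ?_
        have : ∀ c, ((G.predecessors j).filter fun k => s k = c) =
            ((G.predecessors j).filter fun k => f k = c) := fun c =>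
          Finset.filter_congr fun k hk => by rw [hsf k hk]
        simpa only [this] using hfmax
      · exact (bestResponse_update_of_not_edge hji (hsink j hj)).2
          (h2 j (Finset.mem_erase.2 ⟨hji, hj⟩))
    · by_cases hji : j = i
      · subst hji
        rw [Function.update_self]
        exact htq d hd
      · rw [Function.update_of_ne hji]
        exact h3 j (Finset.mem_erase.2 ⟨hji, hj⟩) d hd
    · by_cases hki : k = i
      · subst hki
        rw [Function.update_self]
      -- Another sink of `P` is not a predecessor of `i`, so its target remained `t k`.
      · rw [Function.update_of_ne hki, h4 k (Finset.mem_erase.2 ⟨hki, hk⟩)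
          fun j hj => hk' j (Finset.mem_of_mem_erase hj), if_neg]
        exact fun h => hk' i hi' (mem_predecessors.1 h)

/-- Locally correct sets consist of the colours attained in equilibria. -/
theorem mem_iff_exists_isNE (hG : G.IsDAG) (hout : G.OutDegreeAtMostOne)
    (hX : ∀ i, LocallyCorrect G q X i) (i : Fin n) (c : Fin m) :
    X i c = true ↔ ∃ s : G.JointStrategy, G.IsNE s ∧ (s i).1 = c ∧
      ∀ (j : Fin n) (d : Fin m), Relation.ReflTransGen G.Edge j i → q j = some d →
        (s j).1 = d := by
  classical
  set P : Finset (Fin n) := Finset.univ.filter fun j => Relation.ReflTransGen G.Edge j i with hPdef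
  have hmem : ∀ j, j ∈ P ↔ Relation.ReflTransGen G.Edge j i := by simp [hPdef]
  have hP : AncestorClosed G P := fun j hj k hk =>
    (hmem k).2 (Relation.ReflTransGen.head hk ((hmem j).1 hj))
  have hi : i ∈ P := (hmem i).2 Relation.ReflTransGen.refl
  constructor
  · intro hc
    choose t ht using fun k => exists_mem hG Finset.univ (fun _ _ k _ => Finset.mem_univ k)
      (fun i _ => hX i) k (Finset.mem_univ k)
    obtain ⟨s, h1, h2, h3, h4⟩ := exists_bestResponse_on hG hout P hP (fun i _ => hX i)
      (Function.update t i c) (fun k _ => by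
        by_cases hki : k = i
        · subst hki; simpa using hc
        · rw [Function.update_of_ne hki]; exact ht k)
    obtain ⟨s', h5, h6⟩ := exists_extension hG P hP s h1 h2
    refine ⟨s', h5, ?_, fun j d hj hd => ?_⟩
    -- Among its ancestors `i` is a sink, since an edge back to one of them would close a cycle.
    · rw [h6 i hi, h4 i hi fun j hj hij =>
        hG i (Relation.TransGen.head' hij ((hmem j).1 hj)), Function.update_self]
    · rw [h6 j ((hmem j).2 hj)]
      exact h3 j ((hmem j).2 hj) d hd
  · rintro ⟨s, h1, rfl, h2⟩
    exact mem_of_bestResponse hG P hP (fun i _ => hX i) (fun i => (s i).1) (fun i => (s i).2)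
      (fun i _ => (isNE_iff s).1 h1 i) (fun j hj d hd => h2 j d ((hmem j).1 hj) hd) i hi

/-- Locally correct sets yield an equilibrium consistent with the query. -/
theorem exists_isNE_consistent (hG : G.IsDAG) (hout : G.OutDegreeAtMostOne)
    (hX : ∀ i, LocallyCorrect G q X i) : ∃ s : G.JointStrategy, G.IsNE s ∧ G.Consistent q s := by
  have huniv : AncestorClosed G Finset.univ := fun _ _ k _ => Finset.mem_univ k
  choose t ht using fun k => exists_mem hG Finset.univ huniv (fun i _ => hX i) k
    (Finset.mem_univ k)
  obtain ⟨s, h1, h2, h3, -⟩ := exists_bestResponse_on hG hout Finset.univ huniv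
    (fun i _ => hX i) t (fun k _ => ht k)
  exact ⟨fun i => ⟨s i, h1 i⟩, (isNE_iff _).2 fun i => h2 i (Finset.mem_univ i),
    fun i d hd => h3 i (Finset.mem_univ i) d hd⟩

end Equilibria

/-! ### The algorithm -/

section Main

variable {n m : ℕ} {G : CoordinationGame n m}

theorem sum_card_predecessors (G : CoordinationGame n m) :
    ∑ i, (G.predecessors i).card = G.E.card := by
  rw [Finset.card_eq_sum_card_fiberwise (f := Prod.snd) (t := Finset.univ)
    fun _ _ => Finset.mem_coe.2 (Finset.mem_univ _)]
  refine Finset.sum_congr rfl fun i _ => ?_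
  refine Finset.card_nbij' (fun k => (k, i)) Prod.fst ?_ ?_ ?_ ?_
  · intro k hk
    simpa [CoordinationGame.predecessors] using hk
  · rintro ⟨k, j⟩ h
    obtain ⟨h, rfl⟩ : (k, j) ∈ G.E ∧ j = i := by simpa using h
    simpa [CoordinationGame.predecessors] using h
  · intro k _
    rfl
  · rintro ⟨k, j⟩ h
    obtain ⟨h, rfl⟩ : (k, j) ∈ G.E ∧ j = i := by simpa using h
    rfl

theorem card_edges_le (hout : G.OutDegreeAtMostOne) : G.E.card ≤ n := by
  have : G.E.card ≤ (Finset.univ : Finset (Fin n)).card := by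
    refine Finset.card_le_card_of_injOn Prod.fst (fun _ _ => Finset.mem_coe.2 (Finset.mem_univ _))
      ?_
    rintro ⟨i, j⟩ h ⟨i', j'⟩ h' (rfl : i = i')
    have := Finset.card_le_one.1 (hout i) j (Finset.mem_filter.2 ⟨Finset.mem_univ j, h⟩) j'
      (Finset.mem_filter.2 ⟨Finset.mem_univ j', h'⟩)
    rw [this]
  simpa using this

/-- The processed nodes form an ancestor-closed prefix of the order, and later rounds do not alter
their sets. If `q` is rejected at `v`, a consistent equilibrium would colour the predecessors of `v`
from their sets and would itself support the rejected colour. -/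
theorem algorithm_spec (G : CoordinationGame n m) (L : List (Fin n × Fin n))
    (q : Fin n → Option (Fin m)) (hG : G.IsDAG) (hq : G.IsQuery q) (hnd : L.Nodup)
    (hL : ∀ e, e ∈ L ↔ e ∈ G.E) :
    ((algorithm G L q).val.answer = true → ∀ i, LocallyCorrect G q (algorithm G L q).val.X i) ∧
    ((algorithm G L q).val.answer = false →
      ¬ ∃ s : G.JointStrategy, G.IsNE s ∧ G.Consistent q s) ∧
    (algorithm G L q).time ≤ n * (5 * n + 5 * G.E.card + 8) + 2 + (n + 6 * G.E.card + 1) + n * m +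
      (∑ i, (37 * ((m + 1) * (G.predecessors i).card.succ) ^ 2 + 1) + 1) := by
  obtain ⟨o1, o2, o3, o4⟩ := topologicalSort_spec G hG L hL
  obtain ⟨p1, p2⟩ := predecessorLists_spec G L hnd hL
  have hcard : L.length = G.E.card := by
    rw [← List.toFinset_card_of_nodup hnd]
    congr 1
    ext e
    rw [List.mem_toFinset, hL]
  set order := (topologicalSort L).val with horder
  set N := (predecessorLists L).val with hN
  set body := fun (i : Fin n) (r : Outcome n m) =>
    if r.answer then processNode G q N i r.X else pure r with hbody
  set loop := forEach order ⟨true, fun _ _ => false⟩ body with hloop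
  have hval : (algorithm G L q).val = loop.val := rfl
  have htime : (algorithm G L q).time = (topologicalSort L).time +
    ((predecessorLists L).time + (n * m + loop.time)) := rfl
  obtain ⟨t, ht, h1, h2, h3⟩ := forEach_invariant (fun p (r : Outcome n m) t =>
    (r.answer = true → ∀ i ∈ p, LocallyCorrect G q r.X i) ∧
    (r.answer = false → ¬ ∃ s : G.JointStrategy, G.IsNE s ∧ G.Consistent q s) ∧
    t ≤ (p.map fun i => 37 * ((m + 1) * (G.predecessors i).card.succ) ^ 2 + 1).sum)
    order ⟨true, fun _ _ => false⟩ body (by simp) (by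
      rintro p v l ⟨ans, X⟩ t hl ⟨h1, h2, h3⟩
      simp only at h1 h2 h3
      rw [List.map_append, List.sum_append, List.map_singleton, List.sum_singleton]
      cases ans with
      | false =>
        have hb : body v ⟨false, X⟩ = pure ⟨false, X⟩ := rfl
        rw [hb]
        refine ⟨by simp, fun _ => h2 rfl, ?_⟩
        simp only [pure_time]
        omega
      | true =>
        have hb : body v ⟨true, X⟩ = processNode G q N v X := rfl
        rw [hb]
        have h1 := h1 rfl
        have hvp : v ∉ p := by
          intro h
          rw [hl, List.nodup_append] at o1
          exact o1.2.2 v h v (by simp) rfl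
        have hpv : ∀ k, G.Edge k v → k ∈ p := o3 p v l hl
        have hclosed : ∀ i ∈ p, ∀ k, G.Edge k i → k ∈ p := by
          intro i hi k hk
          obtain ⟨a, b, rfl⟩ := List.append_of_mem hi
          have := o3 a i (b ++ v :: l) (by rw [hl]; simp) k hk
          exact List.mem_append_left _ this
        obtain ⟨k1, k2, k3, k4⟩ := processNode_spec G q N v X (p1 v).1 (p1 v).2 (hq.2 v)
        refine ⟨fun ha i hi => ?_, fun ha => ?_, by omega⟩
        · rcases List.mem_append.1 hi with hip | hip
          · refine (locallyCorrect_congr G q i (fun k hk => k1 k ?_) (k1 i ?_)).2 (h1 i hip)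
            · rintro rfl
              exact hvp (hclosed i hip k (mem_predecessors.1 hk))
            · rintro rfl
              exact hvp hip
          · rw [List.mem_singleton] at hip
            exact hip ▸ k2 ha
        · rintro ⟨s, hs, hsq⟩
          obtain ⟨d, hd, hd'⟩ := k3 ha
          have hbr := (isNE_iff s).1 hs
          have hmem := mem_of_bestResponse hG p.toFinset
            (fun i hi k hk => List.mem_toFinset.2 (hclosed i (List.mem_toFinset.1 hi) k hk))
            (fun i hi => h1 i (List.mem_toFinset.1 hi)) (fun i => (s i).1) (fun i => (s i).2)
            (fun i _ => hbr i) (fun i _ c hc => hsq i c hc)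
          refine hd' ⟨fun i => (s i).1, fun k hk =>
            hmem k (List.mem_toFinset.2 (hpv k (mem_predecessors.1 hk))), ?_⟩
          rw [← hsq v d hd]
          exact hbr v)
  rw [hval, htime]
  refine ⟨fun h i => h1 h i (o2 i), h2, ?_⟩
  have horder_univ : order.toFinset = Finset.univ :=
    Finset.eq_univ_iff_forall.2 fun v => List.mem_toFinset.2 (o2 v)
  rw [← List.sum_toFinset _ o1, horder_univ] at h3
  rw [hcard] at o4 p2
  rw [← hloop] at ht
  omega

/-- The query forces `n, m ≥ 1`, and out-degree at most one gives `|E| ≤ n`. So `∑ (m + 1)(d + 1) =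
(m + 1)(|E| + n) ≤ 4nm`, and the nodes cost `37 * 16 = 592` times `(n * m) ^ 2`, up to lower terms.
Sorting adds at most 18 times the square of the size, and the linear terms fit into the remaining
30. -/
theorem algorithm_time_le (G : CoordinationGame n m) (L : List (Fin n × Fin n))
    (q : Fin n → Option (Fin m)) (hG : G.IsDAG) (hout : G.OutDegreeAtMostOne) (hq : G.IsQuery q)
    (hnd : L.Nodup) (hL : ∀ e, e ∈ L ↔ e ∈ G.E) :
    1 ≤ G.size ∧ (algorithm G L q).time ≤ 640 * G.size ^ 2 := by
  have htime := (algorithm_spec G L q hG hq hnd hL).2.2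
  obtain ⟨⟨i, c, -⟩, -⟩ := hq
  have hn : 1 ≤ n := i.pos
  have hm : 1 ≤ m := c.pos
  have hE := card_edges_le hout
  have hnm : n ≤ n * m := Nat.le_mul_of_pos_right n hm
  have hS : G.size = n * m + G.E.card := rfl
  have hsq : ∑ i, ((m + 1) * (G.predecessors i).card.succ) ^ 2 ≤ 16 * (n * m) ^ 2 := by
    calc ∑ i, ((m + 1) * (G.predecessors i).card.succ) ^ 2
        ≤ (∑ i, (m + 1) * (G.predecessors i).card.succ) ^ 2 :=
          Finset.sum_sq_le_sq_sum_of_nonneg fun _ _ => Nat.zero_le _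
      _ = ((m + 1) * (G.E.card + n)) ^ 2 := by
          rw [← Finset.mul_sum]
          simp only [Nat.succ_eq_add_one, Finset.sum_add_distrib, sum_card_predecessors]
          simp
      _ ≤ ((2 * m) * (2 * n)) ^ 2 :=
          Nat.pow_le_pow_left (Nat.mul_le_mul (by omega) (by omega)) 2
      _ = 16 * (n * m) ^ 2 := by ring
  refine ⟨by omega, htime.trans ?_⟩
  rw [Finset.sum_add_distrib, ← Finset.mul_sum]
  simp only [Finset.sum_const, Finset.card_univ, Fintype.card_fin, smul_eq_mul, mul_one]
  set S := G.size with hS'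
  have h1 : (n * m) ^ 2 ≤ S ^ 2 := Nat.pow_le_pow_left (by omega) 2
  have h2 : n * (5 * n + 5 * G.E.card + 8) ≤ S * (18 * S) :=
    Nat.mul_le_mul (by omega) (by omega)
  have h3 : S ≤ S ^ 2 := Nat.le_self_pow two_ne_zero S
  have h4 : S * (18 * S) = 18 * S ^ 2 := by ring
  omega

end Main
end DagNE

theorem mainTheorem10 :
    ∃ K : ℝ, ∀ (n m : ℕ) (G : DagNE.CoordinationGame n m) (L : List (Fin n × Fin n))
      (q : Fin n → Option (Fin m)),
      G.IsDAG → G.OutDegreeAtMostOne → G.IsQuery q →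
      L.Nodup → (∀ e, e ∈ L ↔ e ∈ G.E) →
        ((DagNE.algorithm G L q).val.answer = true ↔
          ∃ s : G.JointStrategy, G.IsNE s ∧ G.Consistent q s) ∧
        ((DagNE.algorithm G L q).val.answer = true →
          ∀ (i : Fin n) (c : Fin m), (DagNE.algorithm G L q).val.X i c = true ↔
            ∃ s : G.JointStrategy, G.IsNE s ∧ (s i).1 = c ∧
              ∀ (j : Fin n) (d : Fin m), Relation.ReflTransGen G.Edge j i → q j = some d →
                (s j).1 = d) ∧
        ((DagNE.algorithm G L q).time : ℝ) ≤ K * (G.size : ℝ) ^ (5 / 2 : ℝ) := by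
  refine ⟨640, fun n m G L q hG hout hq hnd hL => ?_⟩
  obtain ⟨h1, h2, -⟩ := DagNE.algorithm_spec G L q hG hq hnd hL
  obtain ⟨hpos, htime⟩ := DagNE.algorithm_time_le G L q hG hout hq hnd hL
  refine ⟨⟨fun h => DagNE.exists_isNE_consistent hG hout (h1 h), fun h => ?_⟩,
    fun h => DagNE.mem_iff_exists_isNE hG hout (h1 h), ?_⟩
  · by_contra h'
    exact h2 (by simpa using h') h
  -- As the size is at least 1, raising the exponent from 2 to 5/2 only weakens the bound.
  · have hS : (1 : ℝ) ≤ G.size := by exact_mod_cast hpos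
    calc ((DagNE.algorithm G L q).time : ℝ) ≤ 640 * (G.size : ℝ) ^ 2 := by exact_mod_cast htime
      _ = 640 * (G.size : ℝ) ^ (2 : ℝ) := by rw [Real.rpow_two]
      _ ≤ 640 * (G.size : ℝ) ^ (5 / 2 : ℝ) :=
          mul_le_mul_of_nonneg_left (Real.rpow_le_rpow_of_exponent_le hS (by norm_num))
            (by norm_num)
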